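/- **Theorem (General Integral Quadratic Constraints).** Let $0<T<\infty$ and let $A:[0,T]\to\mathbb R^{n\times n}$, $B:[0,T]\to\mathbb R^{n\times m}$, $Q:[0,T]\to\mathbb R^{n\times n}$, $N:[0,T]\to\mathbb R^{n\times m}$, $R:[0,T]\to\mathbb R^{m\times m}$ be measurable and essentially bounded, with $Q(t)=Q(t)^*$ and $R(t)=R(t)^*\ge\rho I$ for almost every $t$, for some constant $\rho>0$ (for continuous $R$ this just means $R(t)>0$ on $[0,T]$). For $\mathrm x_i\in\mathbb R^n$ consider all pairs $(x,v)$ with $v\in L^2(0,T)$ and $x$ absolutely continuous such that $$\dot x=Ax+Bv \ \text{ a.e. on } [0,T],\qquad x(0)=\mathrm x_i,$$ and the cost $$\mathbf q(x,v)=\int_0^T\begin{bmatrix}x\\v\end{bmatrix}^*\begin{bmatrix}Q&N\\N^*&R\end{bmatrix}\begin{bmatrix}x\\v\end{bmatrix}dt .$$ Let $J(\mathrm x_i)\in[-\infty,\infty)$ be the infimum of $\mathbf q(x,v)$ over these pairs. For symmetric-valued, absolutely continuous $\Lambda$, consider the differential linear matrix inequality (DLMI) $$\begin{bmatrix}Q&N\\N^*&R\end{bmatrix}+\begin{bmatrix}\dot\Lambda+A^*\Lambda+\Lambda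 A&\Lambda B\\B^*\Lambda&0\end{bmatrix}\ge0\ \text{ a.e. on }[0,T],\qquad\Lambda(T)=0,$$ and the differential Riccati equation (DRE) $$Q+\dot\Lambda+A^*\Lambda+\Lambda A-(N+\Lambda B)R^{-1}(N+\Lambda B)^*=0\ \text{ a.e.},\qquad\Lambda(T)=0.$$ A solution $\bar\Lambda$ of the DLMI is called maximal if $\bar\Lambda(t)\ge\Lambda(t)$ for all $t\in[0,T]$ and every solution $\Lambda$ of the DLMI. The DRE is said to escape to infinity at $\tau\in[0,T)$ if it has a solution on $(\tau,T]$ whose norm tends to $\infty$ as $t\downarrow\tau$. 1. A function $\bar\Lambda$ is the maximal solution of the DLMI if and only if it solves the DRE on $[0,T]$; in that case $J(\mathrm x_i)=\mathrm x_i^*\bar\Lambda(0)\mathrm x_i$ for every $\mathrm x_i$. 2. Suppose that the DRE escapes to infinity at some $\tau\in[0,T)$. - There is a proper linear subspace $S\subsetneq\mathbb R^n$ such that $J(\mathrm x_i)=-\infty$ for all $\mathrm x_i\notin S$. - Either $J(\mathrm x_i)=-\infty$ for every $\mathrm x_i\in\mathbb R^n$, or the problem is degenerate in the sense that $J(0)=0$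 and this infimum is attained, for $\mathrm x_i=0$, by an input $v$ that is not almost everywhere zero. - $J(\mathrm x_i)=-\infty$ for every $\mathrm x_i\in\mathbb R^n$ whenever each state at time $\tau$ that can be steered to the origin during $[\tau,T]$ can also be reached from the origin during $[0,\tau]$; and also whenever $\tau>0$ and $A$, $B$ are constant. 3. If the DRE does not escape to infinity at any $\tau\in[0,T)$, then the maximal solution $\bar\Lambda$ of the DLMI exists, and for every $\mathrm x_i$ the optimal input is the static state feedback $$\bar v=-R^{-1}(N^*+B^*\bar\Lambda)\,\bar x:$$ a pair $(\bar x,\bar v)$ with this feedback exists, and a pair $(x,v)$ attains the infimum $J(\mathrm x_i)$ if and only if $v=-R^{-1}(N^*+B^*\bar\Lambda)x$ almost everywhere. -/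

import Mathlib

open MeasureTheory Set Filter Topology
open scoped Matrix

noncomputable section

/-- The data of a linear-quadratic problem on the horizon `[0, T]`: the system `x' = A x + B v`
with `n` states and `m` inputs, and the blocks `Q, N, R` of the weight `[[Q, N], [Nᵀ, R]]`.
All matrices may depend on time. Only their values on `[0, T]` matter. -/
structure LQProblem (n m : ℕ) where
  T : ℝ
  A : ℝ → Matrix (Fin n) (Fin n) ℝ
  B : ℝ → Matrix (Fin n) (Fin m) ℝ
  Q : ℝ → Matrix (Fin n) (Fin n) ℝ
  N : ℝ → Matrix (Fin n) (Fin m) ℝ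
  R : ℝ → Matrix (Fin m) (Fin m) ℝ

/-- The matrix function `M` is measurable and (essentially) bounded on `[0, T]`. -/
def IsBoundedMatrixFun {p q : ℕ} (T : ℝ) (M : ℝ → Matrix (Fin p) (Fin q) ℝ) : Prop :=
  ∀ i j, MemLp (fun t => M t i j) ⊤ (volume.restrict (Icc 0 T))

namespace LQProblem

variable {n m : ℕ} (P : LQProblem n m)

/-- `(x, v)` is a state/input pair of `x' = A x + B v` on `[a, b]`: the input is in `L²(a, b)` and
the state is the (absolutely continuous) Carathéodory solution. -/
def IsTrajectory (a b : ℝ) (x : ℝ → Fin n → ℝ) (v : ℝ → Fin m → ℝ) : Prop :=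
  ContinuousOn x (Icc a b) ∧
  MemLp v 2 (volume.restrict (Icc a b)) ∧
  ∀ t ∈ Icc a b, x t = x a + ∫ s in a..t, (P.A s *ᵥ x s + P.B s *ᵥ v s)

/-- The pairs `(x, v)` on `[0, T]` with initial state `x₀`. -/
def IsAdmissible (x₀ : Fin n → ℝ) (x : ℝ → Fin n → ℝ) (v : ℝ → Fin m → ℝ) : Prop :=
  P.IsTrajectory 0 P.T x v ∧ x 0 = x₀

/-- Some input in `L²(a, b)` steers the state `y` at time `a` to the state `z` at time `b`. -/
def CanSteer (a b : ℝ) (y z : Fin n → ℝ) : Prop :=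
  ∃ x v, P.IsTrajectory a b x v ∧ x a = y ∧ x b = z

/-- The weight `[[Q, N], [Nᵀ, R]]`. -/
def weight (t : ℝ) : Matrix (Fin n ⊕ Fin m) (Fin n ⊕ Fin m) ℝ :=
  Matrix.fromBlocks (P.Q t) (P.N t) (P.N t)ᵀ (P.R t)

/-- The quadratic cost `∫₀ᵀ [x; v]ᵀ [[Q, N], [Nᵀ, R]] [x; v] dt`. -/
def cost (x : ℝ → Fin n → ℝ) (v : ℝ → Fin m → ℝ) : ℝ :=
  ∫ t in (0 : ℝ)..P.T, Sum.elim (x t) (v t) ⬝ᵥ (P.weight t *ᵥ Sum.elim (x t) (v t))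

/-- The infimum, in the extended reals, of the cost over all pairs with initial state `x₀`. -/
def infCost (x₀ : Fin n → ℝ) : EReal :=
  sInf {c : EReal | ∃ x v, P.IsAdmissible x₀ x v ∧ c = (P.cost x v : EReal)}

/-- On `[a, T]`, `Λ` is a symmetric-valued absolutely continuous matrix function with (almost
everywhere) derivative `D` and with `Λ(T) = 0`, that is, `Λ(t) = - ∫ₜᵀ D`. -/
def HasDerivFinalZero (a : ℝ) (Λ D : ℝ → Matrix (Fin n) (Fin n) ℝ) : Prop :=
  (∀ i j, IntervalIntegrable (fun t => D t i j) volume a P.T) ∧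
  (∀ t ∈ Icc a P.T, ∀ i j, Λ t i j = - ∫ s in t..P.T, D s i j) ∧
  ∀ t ∈ Icc a P.T, (Λ t).IsSymm

/-- `Λ` solves the differential linear matrix inequality
`[[Q, N], [Nᵀ, R]] + [[Λ' + Aᵀ Λ + Λ A, Λ B], [Bᵀ Λ, 0]] ≥ 0` on `[0, T]`, `Λ(T) = 0`. -/
def IsDLMISolution (Λ : ℝ → Matrix (Fin n) (Fin n) ℝ) : Prop :=
  ∃ D, P.HasDerivFinalZero 0 Λ D ∧
    ∀ᵐ t ∂(volume.restrict (Icc 0 P.T)),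
      (P.weight t + Matrix.fromBlocks (D t + (P.A t)ᵀ * Λ t + Λ t * P.A t) (Λ t * P.B t)
        ((P.B t)ᵀ * Λ t) 0).PosSemidef

/-- `Λ` is the maximal solution of the DLMI: a solution that dominates every solution, at every
time in `[0, T]`, in the Loewner order. -/
def IsMaximalDLMISolution (Λ : ℝ → Matrix (Fin n) (Fin n) ℝ) : Prop :=
  P.IsDLMISolution Λ ∧
    ∀ Λ', P.IsDLMISolution Λ' → ∀ t ∈ Icc 0 P.T, (Λ t - Λ' t).PosSemidef

/-- `Λ` solves the differential Riccati equation
`Q + Λ' + Aᵀ Λ + Λ A - (N + Λ B) R⁻¹ (N + Λ B)ᵀ = 0` on `[a, T]`, `Λ(T) = 0`. -/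
def IsDRESolution (a : ℝ) (Λ : ℝ → Matrix (Fin n) (Fin n) ℝ) : Prop :=
  ∃ D, P.HasDerivFinalZero a Λ D ∧
    ∀ᵐ t ∂(volume.restrict (Icc a P.T)),
      P.Q t + D t + (P.A t)ᵀ * Λ t + Λ t * P.A t
        - (P.N t + Λ t * P.B t) * (P.R t)⁻¹ * (P.N t + Λ t * P.B t)ᵀ = 0

/-- The solution of the Riccati equation, run backwards from `Λ(T) = 0`, escapes to infinity at
the time `τ ∈ [0, T)`: it exists on `(τ, T]`, and its (squared Frobenius) norm tends to infinity
as `t` decreases to `τ`. -/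
def DREEscapesAt (τ : ℝ) : Prop :=
  τ ∈ Ico 0 P.T ∧ ∃ Λ, (∀ a ∈ Ioc τ P.T, P.IsDRESolution a Λ) ∧
    Tendsto (fun t => ∑ i, ∑ j, (Λ t i j) ^ 2) (𝓝[>] τ) atTop

/-- The static state feedback `v = - R⁻¹ (Nᵀ + Bᵀ Λ) x`, for almost every `t ∈ [0, T]`. -/
def IsFeedback (Λ : ℝ → Matrix (Fin n) (Fin n) ℝ) (x : ℝ → Fin n → ℝ) (v : ℝ → Fin m → ℝ) :
    Prop :=
  ∀ᵐ t ∂(volume.restrict (Icc 0 P.T)),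
    v t = -(((P.R t)⁻¹ * ((P.N t)ᵀ + (P.B t)ᵀ * Λ t)) *ᵥ x t)

end LQProblem

end

/-! The proof linearises the Riccati equation. Let `(X, Y)` solve the Hamiltonian system of state
and costate with `X(T) = 1`, `Y(T) = 0`. A Riccati solution `Λ` on `[a, T]` satisfies `Y = Λ X` and
forces `X` to be invertible there (`IsDRESolution.terminalSolution`). Conversely `Y X⁻¹` solves the
equation wherever `X` stays invertible up to `T` (`IsTerminalSolution.isDRESolution`). Hence finite
escape means exactly that `X` becomes singular somewhere (`DREEscapesAt.not_isUnit_det`,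
`IsTerminalSolution.exists_escape`).

If `X` is invertible on `[0, T]`, integrating the derivative of `x · Λ x` and completing the square
gives cost `= x₀ · Λ(0) x₀ + ∫ e · R e`, where `e` is the deviation from the feedback
(`IsDRESolution.integral_form_eq`). Coercivity of `R` makes the feedback the only optimal input. Any
DLMI solution gives a lower bound for the cost on `[t, T]`, and the closed loop started at time `t`
attains the value of `Λ(t)`, so `Λ` is maximal.

If `X(τ) ξ = 0` with `ξ ≠ 0`, then `η = Y(τ) ξ ≠ 0`, because a Hamiltonian solution cannot vanish at
one time only. Resting at the origin up to `τ` and then following `X ξ` gives a trajectory with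
nonzero input whose cost pairing with every trajectory `z` is `η · z(τ)`
(`IsTerminalSolution.exists_isDegenerate`). Its own cost is therefore zero. Adding multiples of it
changes the cost of `z` affinely, with slope `2 η · z(τ)`, so the infimum is `-∞` as soon as some
admissible `z` has `η · z(τ) ≠ 0`. With zero input this happens for all initial states off a
hyperplane.

It happens for all initial states if some state `y` reachable from the origin by time `τ` has `η · y
≠ 0`. Such `y` come from inputs `Bᵀ p`, with `p` the adjoint solution through `η`: the pairing `p ·
z` then grows by `∫ |Bᵀ p|²`. This is nonzero on `[τ, T]` by uniqueness for the Hamiltonian system,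
and on `[0, τ]` by analyticity when `A`, `B` are constant.

Finally, a maximal DLMI solution bounds the infimum below at every initial state, which excludes
singular `X`; it then coincides with the Riccati solution. -/

/-- On `[a, b]`, `f` is absolutely continuous with almost everywhere derivative `f'`. -/
def IsPrimitiveOn (f f' : ℝ → ℝ) (a b : ℝ) : Prop :=
  IntegrableOn f' (Icc a b) ∧ ∀ t ∈ Icc a b, f t = f a + ∫ s in a..t, f' s

theorem MeasureTheory.IntegrableOn.intervalIntegrable_of_mem {E : Type*} [NormedAddCommGroup E] {f : ℝ → E}
    {a b s t : ℝ} (h : IntegrableOn f (Icc a b)) (hs : s ∈ Icc a b) (ht : t ∈ Icc a b) :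
    IntervalIntegrable f volume s t :=
  (h.mono_set (uIcc_subset_Icc hs ht)).intervalIntegrable

/-! ### Calculus of absolutely continuous functions. -/

namespace IsPrimitiveOn

variable {f f' g g' : ℝ → ℝ} {a b c : ℝ}

theorem sub_eq (h : IsPrimitiveOn f f' a b) {s t : ℝ} (hs : s ∈ Icc a b) (ht : t ∈ Icc a b) :
    f t - f s = ∫ r in s..t, f' r := by
  have ha : a ∈ Icc a b := ⟨le_rfl, hs.1.trans hs.2⟩
  rw [h.2 t ht, h.2 s hs, add_sub_add_left_eq_sub]
  exact intervalIntegral.integral_interval_sub_left (IntegrableOn.intervalIntegrable_of_mem h.1 ha ht)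
    (IntegrableOn.intervalIntegrable_of_mem h.1 ha hs)

theorem of_base {t₀ : ℝ} (hi : IntegrableOn f' (Icc a b)) (ht₀ : t₀ ∈ Icc a b)
    (h : ∀ t ∈ Icc a b, f t = f t₀ + ∫ s in t₀..t, f' s) : IsPrimitiveOn f f' a b := by
  refine ⟨hi, fun t ht => ?_⟩
  have ha : a ∈ Icc a b := ⟨le_rfl, ht.1.trans ht.2⟩
  have := intervalIntegral.integral_add_adjacent_intervals
    (IntegrableOn.intervalIntegrable_of_mem hi ht₀ ha)
    (IntegrableOn.intervalIntegrable_of_mem hi ha ht)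
  rw [h t ht, h a ha, ← this, add_assoc]

theorem continuousOn (h : IsPrimitiveOn f f' a b) : ContinuousOn f (Icc a b) := by
  have : ContinuousOn (fun t => f a + ∫ s in a..t, f' s) (Icc a b) := by
    refine continuousOn_const.add ?_
    rcases le_or_gt a b with hab | hab
    · have := intervalIntegral.continuousOn_primitive_interval (f := f') (μ := volume) (a := a)
        (b := b) (by rw [uIcc_of_le hab]; exact h.1)
      rwa [uIcc_of_le hab] at this
    · simp [Icc_eq_empty_of_lt hab]
  exact this.congr h.2

theorem mono (h : IsPrimitiveOn f f' a b) {c d : ℝ} (hc : a ≤ c) (hd : d ≤ b) :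
    IsPrimitiveOn f f' c d := by
  refine ⟨h.1.mono_set (Icc_subset_Icc hc hd), fun t ht => ?_⟩
  rw [← h.sub_eq (s := c) (t := t) ⟨hc, ht.1.trans (ht.2.trans hd)⟩
    ⟨hc.trans ht.1, ht.2.trans hd⟩]
  ring

theorem congr (h : IsPrimitiveOn f f' a b) (hf : ∀ t ∈ Icc a b, g t = f t)
    (hf' : ∀ᵐ t ∂(volume.restrict (Icc a b)), g' t = f' t) : IsPrimitiveOn g g' a b := by
  refine ⟨Integrable.congr h.1 (hf'.mono fun t ht => ht.symm), fun t ht => ?_⟩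
  have ha : a ∈ Icc a b := ⟨le_rfl, ht.1.trans ht.2⟩
  rw [hf t ht, hf a ha, h.2 t ht]
  congr 1
  apply intervalIntegral.integral_congr_ae
  rw [ae_restrict_iff' measurableSet_Icc] at hf'
  filter_upwards [hf'] with s hs hst
  rw [uIoc_of_le ht.1] at hst
  exact (hs ⟨hst.1.le, hst.2.trans ht.2⟩).symm

theorem congr_deriv (h : IsPrimitiveOn f f' a b)
    (hf' : ∀ᵐ t ∂(volume.restrict (Icc a b)), g' t = f' t) : IsPrimitiveOn f g' a b :=
  h.congr (fun _ _ => rfl) hf'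

theorem glue (hab : a ≤ b) (hbc : b ≤ c) (h₁ : IsPrimitiveOn f f' a b)
    (h₂ : IsPrimitiveOn f f' b c) : IsPrimitiveOn f f' a c := by
  have hi : IntegrableOn f' (Icc a c) := by
    rw [← Icc_union_Icc_eq_Icc hab hbc]; exact h₁.1.union h₂.1
  refine ⟨hi, fun t ht => ?_⟩
  rcases le_total t b with htb | htb
  · exact h₁.2 t ⟨ht.1, htb⟩
  · rw [h₂.2 t ⟨htb, ht.2⟩, h₁.2 b ⟨hab, le_rfl⟩, add_assoc,
      intervalIntegral.integral_add_adjacent_intervals]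
    · exact IntegrableOn.intervalIntegrable_of_mem hi ⟨le_rfl, hab.trans hbc⟩ ⟨hab, hbc⟩
    · exact IntegrableOn.intervalIntegrable_of_mem hi ⟨hab, hbc⟩ ht

theorem const (k a b : ℝ) : IsPrimitiveOn (fun _ => k) (fun _ => 0) a b :=
  ⟨integrableOn_zero, by simp⟩

theorem add (hf : IsPrimitiveOn f f' a b) (hg : IsPrimitiveOn g g' a b) :
    IsPrimitiveOn (fun t => f t + g t) (fun t => f' t + g' t) a b := by
  refine ⟨hf.1.add hg.1, fun t ht => ?_⟩
  have ha : a ∈ Icc a b := ⟨le_rfl, ht.1.trans ht.2⟩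
  rw [intervalIntegral.integral_add (IntegrableOn.intervalIntegrable_of_mem hf.1 ha ht)
    (IntegrableOn.intervalIntegrable_of_mem hg.1 ha ht)]
  linear_combination hf.2 t ht + hg.2 t ht

theorem sum {ι : Type*} (s : Finset ι) {f f' : ι → ℝ → ℝ}
    (h : ∀ i ∈ s, IsPrimitiveOn (f i) (f' i) a b) :
    IsPrimitiveOn (fun t => ∑ i ∈ s, f i t) (fun t => ∑ i ∈ s, f' i t) a b := by
  classical
  induction s using Finset.induction_on with
  | empty => simpa using const 0 a b
  | insert i s hi ih =>
    simp_rw [Finset.sum_insert hi]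
    exact (h i (Finset.mem_insert_self i s)).add
      (ih fun j hj => h j (Finset.mem_insert_of_mem hj))

/-- Integration by parts for absolutely continuous functions, applied to the primitives that `f` and
`g` agree with. Their pointwise derivatives equal `f'` and `g'` only almost everywhere, which
suffices under the integral. -/
theorem mul (hf : IsPrimitiveOn f f' a b) (hg : IsPrimitiveOn g g' a b) :
    IsPrimitiveOn (fun t => f t * g t) (fun t => f' t * g t + f t * g' t) a b := by
  refine ⟨(hf.1.mul_continuousOn hg.continuousOn isCompact_Icc).add
    (hg.1.continuousOn_mul hf.continuousOn isCompact_Icc), fun t ht => ?_⟩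
  have hat : uIcc a t = Icc a t := uIcc_of_le ht.1
  have hfi : IntervalIntegrable f' volume a t :=
    IntegrableOn.intervalIntegrable_of_mem hf.1 ⟨le_rfl, ht.1.trans ht.2⟩ ht
  have hgi : IntervalIntegrable g' volume a t :=
    IntegrableOn.intervalIntegrable_of_mem hg.1 ⟨le_rfl, ht.1.trans ht.2⟩ ht
  have hF : AbsolutelyContinuousOnInterval (fun x => f a + ∫ s in a..x, f' s) a t := by
    have := (hfi.absolutelyContinuousOnInterval_intervalIntegral (c := a) left_mem_uIcc)
    exact (LipschitzOnWith.absolutelyContinuousOnInterval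
      (LipschitzWith.const (f a)).lipschitzOnWith).add this
  have hG : AbsolutelyContinuousOnInterval (fun x => g a + ∫ s in a..x, g' s) a t := by
    have := (hgi.absolutelyContinuousOnInterval_intervalIntegral (c := a) left_mem_uIcc)
    exact (LipschitzOnWith.absolutelyContinuousOnInterval
      (LipschitzWith.const (g a)).lipschitzOnWith).add this
  have key := hF.integral_deriv_mul_eq_sub hG
  simp only [intervalIntegral.integral_same, add_zero] at key
  rw [← hf.2 t ht, ← hg.2 t ht] at key
  rw [← sub_eq_iff_eq_add', ← key]
  apply intervalIntegral.integral_congr_ae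
  filter_upwards [hfi.ae_hasDerivAt_integral, hgi.ae_hasDerivAt_integral] with s h₁ h₂ hs
  have hs' := uIoc_subset_uIcc hs
  have hsb : s ∈ Icc a b := by rw [hat] at hs'; exact ⟨hs'.1, hs'.2.trans ht.2⟩
  rw [((h₁ hs' a left_mem_uIcc).const_add (f a)).deriv,
    ((h₂ hs' a left_mem_uIcc).const_add (g a)).deriv, ← hf.2 s hsb, ← hg.2 s hsb]

theorem neg (hf : IsPrimitiveOn f f' a b) :
    IsPrimitiveOn (fun t => -f t) (fun t => -f' t) a b := by
  refine ⟨hf.1.neg, fun t ht => ?_⟩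
  rw [intervalIntegral.integral_neg]
  linear_combination -hf.2 t ht

theorem of_hasDerivAt (hd : ∀ t, HasDerivAt f (f' t) t) (hc : Continuous f') :
    IsPrimitiveOn f f' a b := by
  refine ⟨hc.integrableOn_Icc, fun t _ => ?_⟩
  rw [intervalIntegral.integral_eq_sub_of_hasDerivAt (fun x _ => hd x)
    (hc.intervalIntegrable _ _)]
  ring

end IsPrimitiveOn

/-! ### Carathéodory differential equations by Picard iteration. -/

section Caratheodory

variable {E : Type*} [NormedAddCommGroup E] [NormedSpace ℝ E]
  {a b t₀ K : ℝ} {f : ℝ → E → E}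

/-- A field that is integrable along continuous curves and uniformly Lipschitz in the state. -/
structure IsLipschitzField (f : ℝ → E → E) (K a b : ℝ) : Prop where
  nonneg : 0 ≤ K
  integrableOn : ∀ y : ℝ → E, ContinuousOn y (Icc a b) →
    IntegrableOn (fun s => f s (y s)) (Icc a b)
  lipschitz : ∀ᵐ s ∂(volume.restrict (Icc a b)), ∀ y z, ‖f s y - f s z‖ ≤ K * ‖y - z‖

/-- The Picard operator of an integral equation on `[a, b]` with data at `t₀`. -/
noncomputable def picardMap (hf : IsLipschitzField f K a b) (ht₀ : t₀ ∈ Icc a b) (y₀ : E)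
    (y : C(Icc a b, E)) : C(Icc a b, E) where
  toFun t := y₀ + ∫ s in t₀..(t : ℝ), f s (IccExtend (ht₀.1.trans ht₀.2) y s)
  continuous_toFun := by
    have hab := ht₀.1.trans ht₀.2
    have hi := hf.integrableOn (IccExtend hab y) (y.continuous.Icc_extend' (h := hab)).continuousOn
    have h := intervalIntegral.continuousOn_primitive_interval' (μ := volume) (a := t₀)
      (b₁ := a) (b₂ := b)
      (IntegrableOn.intervalIntegrable_of_mem hi (left_mem_Icc.2 hab) (right_mem_Icc.2 hab))
      (by rwa [uIcc_of_le hab])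
    rw [uIcc_of_le hab] at h
    exact (continuousOn_const.add h).domRestrict

/-- Each application integrates the previous bound once more, and this produces the factorial. The
absolute value allows data at an interior time, with the equation solved in both directions. -/
theorem dist_iterate_picardMap_apply_le (hf : IsLipschitzField f K a b) (ht₀ : t₀ ∈ Icc a b)
    (y₀ : E) (y z : C(Icc a b, E)) (n : ℕ) (t : Icc a b) :
    dist ((picardMap hf ht₀ y₀)^[n] y t) ((picardMap hf ht₀ y₀)^[n] z t) ≤
      (K * |t.1 - t₀|) ^ n / n.factorial * dist y z := by
  have hab := ht₀.1.trans ht₀.2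
  have hK := hf.nonneg
  induction n generalizing t with
  | zero => simpa using ContinuousMap.dist_apply_le_dist (f := y) (g := z) t
  | succ n hn =>
    rw [Function.iterate_succ_apply', Function.iterate_succ_apply']
    set u := (picardMap hf ht₀ y₀)^[n] y
    set w := (picardMap hf ht₀ y₀)^[n] z
    have hi : ∀ u : C(Icc a b, E),
        IntervalIntegrable (fun s => f s (IccExtend hab u s)) volume t₀ t := fun u =>
      IntegrableOn.intervalIntegrable_of_mem (hf.integrableOn (IccExtend hab u)
        (u.continuous.Icc_extend' (h := hab)).continuousOn) ht₀ t.2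
    rw [dist_eq_norm]
    change ‖(y₀ + ∫ s in t₀..(t : ℝ), f s (IccExtend hab u s)) -
      (y₀ + ∫ s in t₀..(t : ℝ), f s (IccExtend hab w s))‖ ≤ _
    rw [add_sub_add_left_eq_sub]
    rw [← intervalIntegral.integral_sub (hi u) (hi w)]
    have hL := hf.lipschitz
    rw [ae_restrict_iff' measurableSet_Icc] at hL
    calc
      _ ≤ ∫ s in uIoc t₀ t.1, K ^ (n + 1) * |s - t₀| ^ n / n.factorial * dist y z := by
        rw [intervalIntegral.norm_intervalIntegral_eq]
        apply MeasureTheory.norm_integral_le_of_norm_le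
          (Continuous.integrableOn_uIoc (by fun_prop))
        filter_upwards [ae_restrict_mem measurableSet_uIoc, ae_restrict_of_ae hL] with s hs hLs
        have hs' : s ∈ Icc a b := uIoc_subset_uIcc.trans (uIcc_subset_Icc ht₀ t.2) hs
        refine (hLs hs' _ _).trans ?_
        rw [← dist_eq_norm, IccExtend_of_mem _ _ hs', IccExtend_of_mem _ _ hs']
        calc _ ≤ K * ((K * |s - t₀|) ^ n / n.factorial * dist y z) := by
              gcongr; exact hn ⟨s, hs'⟩
          _ = _ := by rw [mul_pow]; ring
      _ ≤ _ := by
        rw [integral_mul_const, integral_div, integral_const_mul, integral_pow_abs_sub_uIoc,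
          Nat.factorial_succ, mul_pow, Nat.cast_mul, Nat.cast_succ, mul_div_assoc', div_div]

theorem exists_contractingWith_iterate_picardMap (hf : IsLipschitzField f K a b)
    (ht₀ : t₀ ∈ Icc a b) (y₀ : E) :
    ∃ (n : ℕ) (C : NNReal), ContractingWith C (picardMap hf ht₀ y₀)^[n] := by
  have hK := hf.nonneg
  have hab := ht₀.1.trans ht₀.2
  obtain ⟨n, hn⟩ := FloorSemiring.tendsto_pow_div_factorial_atTop (K * (b - a))
    |>.eventually (gt_mem_nhds zero_lt_one) |>.exists
  have h0 : (0 : ℝ) ≤ (K * (b - a)) ^ n / n.factorial := by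
    have : 0 ≤ b - a := by linarith
    positivity
  refine ⟨n, ((K * (b - a)) ^ n / n.factorial).toNNReal, by simpa using hn, LipschitzWith.of_dist_le_mul fun y z => ?_⟩
  rw [Real.coe_toNNReal _ h0, ContinuousMap.dist_le (mul_nonneg h0 dist_nonneg)]
  intro t
  refine (dist_iterate_picardMap_apply_le hf ht₀ y₀ y z n t).trans ?_
  gcongr
  rw [abs_le]
  constructor <;> linarith [ht₀.1, ht₀.2, t.2.1, t.2.2]

theorem IsLipschitzField.exists_solution [CompleteSpace E] (hf : IsLipschitzField f K a b)
    (ht₀ : t₀ ∈ Icc a b) (y₀ : E) :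
    ∃ x : ℝ → E, Continuous x ∧ ∀ t ∈ Icc a b, x t = y₀ + ∫ s in t₀..t, f s (x s) := by
  obtain ⟨n, C, hC⟩ := exists_contractingWith_iterate_picardMap hf ht₀ y₀
  have : Nonempty (Icc a b) := ⟨⟨t₀, ht₀⟩⟩
  -- The fixed point of a contracting iterate is also fixed by the map itself.
  have hfix := hC.isFixedPt_fixedPoint_iterate
  set y := ContractingWith.fixedPoint _ hC
  have hab := ht₀.1.trans ht₀.2
  refine ⟨IccExtend hab y, y.continuous.Icc_extend' (h := hab), fun t ht => ?_⟩
  rw [IccExtend_of_mem _ _ ht]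
  exact (congrArg (fun y : C(Icc a b, E) => y ⟨t, ht⟩) hfix).symm

theorem IsLipschitzField.unique [CompleteSpace E] (hf : IsLipschitzField f K a b)
    (ht₀ : t₀ ∈ Icc a b) {y₀ : E} {x z : ℝ → E} (hx : ContinuousOn x (Icc a b))
    (hz : ContinuousOn z (Icc a b))
    (hx' : ∀ t ∈ Icc a b, x t = y₀ + ∫ s in t₀..t, f s (x s))
    (hz' : ∀ t ∈ Icc a b, z t = y₀ + ∫ s in t₀..t, f s (z s)) : EqOn x z (Icc a b) := by
  obtain ⟨n, C, hC⟩ := exists_contractingWith_iterate_picardMap hf ht₀ y₀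
  have hfix : ∀ (w : ℝ → E) (hw : ContinuousOn w (Icc a b)),
      (∀ t ∈ Icc a b, w t = y₀ + ∫ s in t₀..t, f s (w s)) →
      Function.IsFixedPt (picardMap hf ht₀ y₀) ⟨(Icc a b).domRestrict w, hw.domRestrict⟩ := by
    intro w hw h
    ext t
    change y₀ + _ = w t
    rw [h t t.2]
    congr 1
    apply intervalIntegral.integral_congr
    intro s hs
    have hs' : s ∈ Icc a b := uIcc_subset_Icc ht₀ t.2 hs
    simp only
    rw [IccExtend_of_mem _ _ hs']
    rfl
  have := hC.fixedPoint_unique' ((hfix x hx hx').iterate n) ((hfix z hz hz').iterate n)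
  intro t ht
  exact congrArg (fun y : C(Icc a b, E) => y ⟨t, ht⟩) this

end Caratheodory

/-! ### Matrix functions with entries in Lᵖ. -/

section MemLp

variable {ι κ ν : Type*} {a b : ℝ} {p : ENNReal} {μ : Measure ℝ}

theorem ContinuousOn.memLp_top_Icc {f : ℝ → ℝ} (hf : ContinuousOn f (Icc a b)) :
    MemLp f ⊤ (volume.restrict (Icc a b)) := by
  obtain ⟨C, hC⟩ := isCompact_Icc.exists_bound_of_continuousOn hf
  refine memLp_top_of_bound (hf.aestronglyMeasurable measurableSet_Icc) C ?_
  filter_upwards [ae_restrict_mem measurableSet_Icc] with t ht using hC t ht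

/-- All entries of the matrix function `M` are in `Lᵖ(μ)`. -/
def MatrixMemLp (M : ℝ → Matrix ι κ ℝ) (p : ENNReal) (μ : Measure ℝ) : Prop :=
  ∀ i j, MemLp (fun t => M t i j) p μ

namespace MatrixMemLp

variable {M M' : ℝ → Matrix ι κ ℝ} {N : ℝ → Matrix κ ν ℝ}

theorem mul [Fintype κ] (hM : MatrixMemLp M ⊤ μ) (hN : MatrixMemLp N p μ) :
    MatrixMemLp (fun t => M t * N t) p μ := by
  intro i j
  simp only [Matrix.mul_apply]
  exact memLp_finsetSum _ fun k _ => (hN k j).mul' (hM i k)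

theorem mulVec [Fintype κ] {x : ℝ → κ → ℝ} (hM : MatrixMemLp M ⊤ μ)
    (hx : ∀ j, MemLp (fun t => x t j) p μ) (i : ι) : MemLp (fun t => (M t *ᵥ x t) i) p μ := by
  simp only [Matrix.mulVec, dotProduct]
  exact memLp_finsetSum _ fun k _ => (hx k).mul' (hM i k)

theorem add (hM : MatrixMemLp M p μ) (hM' : MatrixMemLp M' p μ) :
    MatrixMemLp (fun t => M t + M' t) p μ := fun i j => (hM i j).add (hM' i j)

theorem sub (hM : MatrixMemLp M p μ) (hM' : MatrixMemLp M' p μ) :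
    MatrixMemLp (fun t => M t - M' t) p μ := fun i j => (hM i j).sub (hM' i j)

theorem neg (hM : MatrixMemLp M p μ) : MatrixMemLp (fun t => -M t) p μ :=
  fun i j => (hM i j).neg

theorem transpose (hM : MatrixMemLp M p μ) : MatrixMemLp (fun t => (M t)ᵀ) p μ :=
  fun i j => hM j i

theorem mono {c d : ℝ} (hM : MatrixMemLp M p (volume.restrict (Icc a b))) (hc : a ≤ c)
    (hd : d ≤ b) : MatrixMemLp M p (volume.restrict (Icc c d)) := fun i j =>
  (hM i j).mono_measure (Measure.restrict_mono (Icc_subset_Icc hc hd) le_rfl)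

theorem of_continuousOn (hM : ∀ i j, ContinuousOn (fun t => M t i j) (Icc a b)) :
    MatrixMemLp M ⊤ (volume.restrict (Icc a b)) := fun i j => (hM i j).memLp_top_Icc

theorem fromBlocks {α β : Type*} {A : ℝ → Matrix ι κ ℝ} {B : ℝ → Matrix ι α ℝ}
    {C : ℝ → Matrix β κ ℝ} {D : ℝ → Matrix β α ℝ} (hA : MatrixMemLp A p μ)
    (hB : MatrixMemLp B p μ) (hC : MatrixMemLp C p μ) (hD : MatrixMemLp D p μ) :
    MatrixMemLp (fun t => Matrix.fromBlocks (A t) (B t) (C t) (D t)) p μ := by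
  rintro (i | i) (j | j)
  exacts [hA i j, hB i j, hC i j, hD i j]

theorem exists_bound [Finite ι] [Finite κ] (hM : MatrixMemLp M ⊤ μ) :
    ∃ C : ℝ, 0 ≤ C ∧ ∀ᵐ t ∂μ, ∀ i j, |M t i j| ≤ C := by
  have := Fintype.ofFinite ι
  have := Fintype.ofFinite κ
  have h : ∀ i j, ∃ C : ℝ, 0 ≤ C ∧ ∀ᵐ t ∂μ, |M t i j| ≤ C := by
    intro i j
    refine ⟨(eLpNorm (fun t => M t i j) ⊤ μ).toReal, ENNReal.toReal_nonneg, ?_⟩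
    filter_upwards [ae_le_eLpNormEssSup (f := fun t => M t i j) (μ := μ)] with t ht
    rw [← Real.norm_eq_abs, ← toReal_enorm]
    exact ENNReal.toReal_mono (hM i j).2.ne (by simpa using ht)
  choose C hC0 hC using h
  refine ⟨∑ i, ∑ j, C i j, Finset.sum_nonneg fun i _ => Finset.sum_nonneg fun j _ => hC0 i j, ?_⟩
  have : ∀ᵐ t ∂μ, ∀ i j, |M t i j| ≤ C i j :=
    ae_all_iff.2 fun i => ae_all_iff.2 fun j => hC i j
  filter_upwards [this] with t ht i j
  calc |M t i j| ≤ C i j := ht i j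
    _ ≤ ∑ j, C i j := Finset.single_le_sum (fun j _ => hC0 i j) (Finset.mem_univ j)
    _ ≤ _ := Finset.single_le_sum (f := fun i => ∑ j, C i j)
      (fun i _ => Finset.sum_nonneg fun j _ => hC0 i j) (Finset.mem_univ i)

end MatrixMemLp

theorem MeasureTheory.MemLp.integrableOn_Icc {f : ℝ → ℝ} (hp : 1 ≤ p)
    (hf : MemLp f p (volume.restrict (Icc a b))) : IntegrableOn f (Icc a b) :=
  hf.integrable hp

end MemLp

/-! ### Absolutely continuous vector and matrix functions. -/

section Primitive

variable {ι κ ν : Type*} {a b c : ℝ}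

/-- Entrywise version of `IsPrimitiveOn`. -/
def IsMatrixPrimitiveOn (F F' : ℝ → Matrix ι κ ℝ) (a b : ℝ) : Prop :=
  ∀ i j, IsPrimitiveOn (fun t => F t i j) (fun t => F' t i j) a b

/-- Coordinatewise version of `IsPrimitiveOn`. -/
def IsVectorPrimitiveOn (x x' : ℝ → ι → ℝ) (a b : ℝ) : Prop :=
  ∀ i, IsPrimitiveOn (fun t => x t i) (fun t => x' t i) a b

namespace IsVectorPrimitiveOn

variable {x x' y y' : ℝ → ι → ℝ}

theorem congr (h : IsVectorPrimitiveOn x x' a b) (hx : ∀ t ∈ Icc a b, y t = x t)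
    (hx' : ∀ᵐ t ∂(volume.restrict (Icc a b)), y' t = x' t) : IsVectorPrimitiveOn y y' a b :=
  fun i => (h i).congr (fun t ht => congrFun (hx t ht) i) (hx'.mono fun _ ht => congrFun ht i)

theorem congr_deriv (h : IsVectorPrimitiveOn x x' a b)
    (hx' : ∀ᵐ t ∂(volume.restrict (Icc a b)), y' t = x' t) : IsVectorPrimitiveOn x y' a b :=
  h.congr (fun _ _ => rfl) hx'

theorem mono (h : IsVectorPrimitiveOn x x' a b) {c d : ℝ} (hc : a ≤ c) (hd : d ≤ b) :
    IsVectorPrimitiveOn x x' c d := fun i => (h i).mono hc hd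

theorem glue (hab : a ≤ b) (hbc : b ≤ c) (h₁ : IsVectorPrimitiveOn x x' a b)
    (h₂ : IsVectorPrimitiveOn x x' b c) : IsVectorPrimitiveOn x x' a c :=
  fun i => (h₁ i).glue hab hbc (h₂ i)

theorem add (hx : IsVectorPrimitiveOn x x' a b) (hy : IsVectorPrimitiveOn y y' a b) :
    IsVectorPrimitiveOn (fun t => x t + y t) (fun t => x' t + y' t) a b :=
  fun i => (hx i).add (hy i)

theorem neg (hx : IsVectorPrimitiveOn x x' a b) :
    IsVectorPrimitiveOn (fun t => -x t) (fun t => -x' t) a b :=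
  fun i => (hx i).neg

theorem const_smul (k : ℝ) (hx : IsVectorPrimitiveOn x x' a b) :
    IsVectorPrimitiveOn (fun t => k • x t) (fun t => k • x' t) a b :=
  fun i => ((IsPrimitiveOn.const k a b).mul (hx i)).congr (fun _ _ => rfl) (by simp)

theorem continuousOn (hx : IsVectorPrimitiveOn x x' a b) : ContinuousOn x (Icc a b) :=
  continuousOn_pi.2 fun i => (hx i).continuousOn

theorem dotProduct [Fintype ι] (hx : IsVectorPrimitiveOn x x' a b)
    (hy : IsVectorPrimitiveOn y y' a b) :
    IsPrimitiveOn (fun t => x t ⬝ᵥ y t) (fun t => x' t ⬝ᵥ y t + x t ⬝ᵥ y' t) a b :=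
  (IsPrimitiveOn.sum Finset.univ fun i _ => (hx i).mul (hy i)).congr (fun _ _ => rfl)
    (by simp [_root_.dotProduct, Finset.sum_add_distrib])

end IsVectorPrimitiveOn

namespace IsMatrixPrimitiveOn

variable {F F' H H' : ℝ → Matrix ι κ ℝ} {G G' : ℝ → Matrix κ ν ℝ}

theorem congr (h : IsMatrixPrimitiveOn F F' a b) (hF : ∀ t ∈ Icc a b, H t = F t)
    (hF' : ∀ᵐ t ∂(volume.restrict (Icc a b)), H' t = F' t) : IsMatrixPrimitiveOn H H' a b :=
  fun i j => (h i j).congr (fun t ht => congrFun (congrFun (hF t ht) i) j)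
    (hF'.mono fun _ ht => congrFun (congrFun ht i) j)

theorem congr_deriv (h : IsMatrixPrimitiveOn F F' a b)
    (hF' : ∀ᵐ t ∂(volume.restrict (Icc a b)), H' t = F' t) : IsMatrixPrimitiveOn F H' a b :=
  h.congr (fun _ _ => rfl) hF'

theorem mono (h : IsMatrixPrimitiveOn F F' a b) {c d : ℝ} (hc : a ≤ c) (hd : d ≤ b) :
    IsMatrixPrimitiveOn F F' c d := fun i j => (h i j).mono hc hd

theorem add (hF : IsMatrixPrimitiveOn F F' a b) (hH : IsMatrixPrimitiveOn H H' a b) :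
    IsMatrixPrimitiveOn (fun t => F t + H t) (fun t => F' t + H' t) a b :=
  fun i j => (hF i j).add (hH i j)

theorem neg (hF : IsMatrixPrimitiveOn F F' a b) :
    IsMatrixPrimitiveOn (fun t => -F t) (fun t => -F' t) a b := fun i j => (hF i j).neg

theorem sub (hF : IsMatrixPrimitiveOn F F' a b) (hH : IsMatrixPrimitiveOn H H' a b) :
    IsMatrixPrimitiveOn (fun t => F t - H t) (fun t => F' t - H' t) a b := by
  simpa only [sub_eq_add_neg] using hF.add hH.neg

theorem transpose (hF : IsMatrixPrimitiveOn F F' a b) :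
    IsMatrixPrimitiveOn (fun t => (F t)ᵀ) (fun t => (F' t)ᵀ) a b := fun i j => hF j i

theorem continuousOn (hF : IsMatrixPrimitiveOn F F' a b) : ContinuousOn F (Icc a b) :=
  continuousOn_pi.2 fun i => continuousOn_pi.2 fun j => (hF i j).continuousOn

theorem memLp_top (hF : IsMatrixPrimitiveOn F F' a b) :
    MatrixMemLp F ⊤ (volume.restrict (Icc a b)) :=
  MatrixMemLp.of_continuousOn fun i j => (hF i j).continuousOn

theorem mul [Fintype κ] (hF : IsMatrixPrimitiveOn F F' a b) (hG : IsMatrixPrimitiveOn G G' a b) :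
    IsMatrixPrimitiveOn (fun t => F t * G t) (fun t => F' t * G t + F t * G' t) a b :=
  fun i j => (IsPrimitiveOn.sum Finset.univ fun k _ => (hF i k).mul (hG k j)).congr
    (fun _ _ => rfl) (by simp [Matrix.mul_apply, Finset.sum_add_distrib])

theorem mulVec [Fintype κ] {x x' : ℝ → κ → ℝ} (hF : IsMatrixPrimitiveOn F F' a b)
    (hx : IsVectorPrimitiveOn x x' a b) :
    IsVectorPrimitiveOn (fun t => F t *ᵥ x t) (fun t => F' t *ᵥ x t + F t *ᵥ x' t) a b :=
  fun i => (IsPrimitiveOn.sum Finset.univ fun k _ => (hF i k).mul (hx k)).congr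
    (fun _ _ => rfl) (by simp [Matrix.mulVec, _root_.dotProduct, Finset.sum_add_distrib])

theorem mulVec_const [Fintype κ] (hF : IsMatrixPrimitiveOn F F' a b) (ξ : κ → ℝ) :
    IsVectorPrimitiveOn (fun t => F t *ᵥ ξ) (fun t => F' t *ᵥ ξ) a b :=
  (hF.mulVec (x := fun _ => ξ) (x' := fun _ => 0)
    fun i => IsPrimitiveOn.const (ξ i) a b).congr_deriv (by simp)

/-- A function with zero derivative is constant. -/
theorem eq_of_deriv_zero (hF : IsMatrixPrimitiveOn F F' a b)
    (h : ∀ᵐ t ∂(volume.restrict (Icc a b)), F' t = 0) {s t : ℝ} (hs : s ∈ Icc a b)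
    (ht : t ∈ Icc a b) : F s = F t := by
  ext i j
  have h0 := (hF i j).congr_deriv (g' := fun _ => 0)
    (h.mono fun t ht => by rw [ht]; rfl)
  have := h0.sub_eq hs ht
  simp only [intervalIntegral.integral_zero] at this
  linarith

end IsMatrixPrimitiveOn

theorem intervalIntegral_apply [Fintype ι] {f : ℝ → ι → ℝ} {s t : ℝ}
    (hf : ∀ i, IntervalIntegrable (fun r => f r i) volume s t) (i : ι) :
    (∫ r in s..t, f r) i = ∫ r in s..t, f r i := by
  simp only [intervalIntegral, Pi.sub_apply]
  rw [eval_integral fun j => (hf j).1, eval_integral fun j => (hf j).2]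

theorem isVectorPrimitiveOn_iff [Fintype ι] {x x' : ℝ → ι → ℝ}
    (hi : ∀ i, IntegrableOn (fun t => x' t i) (Icc a b)) {t₀ : ℝ} (ht₀ : t₀ ∈ Icc a b) :
    IsVectorPrimitiveOn x x' a b ↔ ∀ t ∈ Icc a b, x t = x t₀ + ∫ s in t₀..t, x' s := by
  constructor
  · intro h t ht
    ext i
    rw [Pi.add_apply, intervalIntegral_apply fun j =>
      IntegrableOn.intervalIntegrable_of_mem (hi j) ht₀ ht, ← (h i).sub_eq ht₀ ht]
    ring
  · intro h i
    refine IsPrimitiveOn.of_base (hi i) ht₀ fun t ht => ?_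
    rw [← intervalIntegral_apply fun j =>
      IntegrableOn.intervalIntegrable_of_mem (hi j) ht₀ ht, ← Pi.add_apply, ← h t ht]

end Primitive

/-! ### Linear differential equations with bounded coefficients. -/

section LinearODE

variable {ι κ : Type*} [Fintype ι] {a b t₀ : ℝ} {M : ℝ → Matrix ι ι ℝ}

theorem isLipschitzField_linear (hM : MatrixMemLp M ⊤ (volume.restrict (Icc a b)))
    {g : ℝ → ι → ℝ} (hg : ∀ i, IntegrableOn (fun t => g t i) (Icc a b)) :
    ∃ K, IsLipschitzField (fun s y => M s *ᵥ y + g s) K a b := by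
  obtain ⟨C, hC0, hC⟩ := hM.exists_bound
  -- In the sup norm, a matrix with entries bounded by `C` has operator norm at most the dimension
  -- times `C`.
  refine ⟨Fintype.card ι * C, by positivity, fun y hy => ?_, ?_⟩
  · apply Integrable.of_eval
    intro i
    exact ((hM.mulVec (fun j => (continuousOn_pi.1 hy j).memLp_top_Icc) i).integrableOn_Icc
      le_top).add (hg i)
  · filter_upwards [hC] with s hs y z
    rw [add_sub_add_right_eq_sub, ← Matrix.mulVec_sub]
    refine (pi_norm_le_iff_of_nonneg (by positivity)).2 fun i => ?_
    calc ‖(M s *ᵥ (y - z)) i‖ ≤ ∑ j, ‖M s i j * (y - z) j‖ := norm_sum_le _ _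
      _ ≤ ∑ _j : ι, C * ‖y - z‖ := by
        refine Finset.sum_le_sum fun j _ => ?_
        rw [norm_mul]
        exact mul_le_mul (hs i j) (norm_le_pi_norm _ j) (norm_nonneg _) hC0
      _ = _ := by simp [mul_assoc]

theorem exists_linear_ode_solution (hM : MatrixMemLp M ⊤ (volume.restrict (Icc a b)))
    {g : ℝ → ι → ℝ} (hg : ∀ i, IntegrableOn (fun t => g t i) (Icc a b)) (ht₀ : t₀ ∈ Icc a b)
    (y₀ : ι → ℝ) :
    ∃ y, y t₀ = y₀ ∧ IsVectorPrimitiveOn y (fun s => M s *ᵥ y s + g s) a b := by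
  obtain ⟨K, hK⟩ := isLipschitzField_linear hM hg
  obtain ⟨y, hy, h⟩ := hK.exists_solution ht₀ y₀
  have hy₀ : y t₀ = y₀ := by simpa using h t₀ ht₀
  refine ⟨y, hy₀, (isVectorPrimitiveOn_iff (fun i => ?_) ht₀).2 (hy₀ ▸ h)⟩
  exact (hK.integrableOn y hy.continuousOn).eval i

theorem linear_ode_eq_zero (hM : MatrixMemLp M ⊤ (volume.restrict (Icc a b)))
    (ht₀ : t₀ ∈ Icc a b) {y : ℝ → ι → ℝ}
    (hy : IsVectorPrimitiveOn y (fun s => M s *ᵥ y s) a b) (h₀ : y t₀ = 0) :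
    ∀ t ∈ Icc a b, y t = 0 := by
  obtain ⟨K, hK⟩ := isLipschitzField_linear hM (g := 0) (fun i => integrableOn_zero)
  refine hK.unique ht₀ (y₀ := 0) hy.continuousOn (z := 0) continuousOn_const ?_ (by simp)
  have := (isVectorPrimitiveOn_iff (fun i => (hy i).1) ht₀).1 hy
  simpa [h₀] using this

theorem exists_matrix_ode_solution (hM : MatrixMemLp M ⊤ (volume.restrict (Icc a b)))
    (ht₀ : t₀ ∈ Icc a b) (F₀ : Matrix ι κ ℝ) :
    ∃ F, F t₀ = F₀ ∧ IsMatrixPrimitiveOn F (fun s => M s * F s) a b := by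
  have := fun j => exists_linear_ode_solution hM (g := 0) (fun i => integrableOn_zero) ht₀
    (fun i => F₀ i j)
  choose y hy₀ hy using this
  refine ⟨fun t => Matrix.of fun i j => y j t i, ?_, fun i j => (hy j i).congr_deriv ?_⟩
  · ext i j
    exact congrFun (hy₀ j) i
  · simp [Matrix.mul_apply, Matrix.mulVec, dotProduct]

theorem matrix_ode_eq_zero (hM : MatrixMemLp M ⊤ (volume.restrict (Icc a b)))
    (ht₀ : t₀ ∈ Icc a b) {F : ℝ → Matrix ι κ ℝ}
    (hF : IsMatrixPrimitiveOn F (fun s => M s * F s) a b) (h₀ : F t₀ = 0) :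
    ∀ t ∈ Icc a b, F t = 0 := by
  intro t ht
  ext i j
  refine congrFun (linear_ode_eq_zero hM ht₀ (y := fun t i => F t i j) (fun i => hF i j) ?_ t ht) i
  ext i
  simp [h₀]

end LinearODE

/-! ### Measurability and bounds for inverse matrices. -/

theorem aestronglyMeasurable_matrix {ι κ : Type*} [Countable ι] [Countable κ]
    {μ : Measure ℝ} {M : ℝ → Matrix ι κ ℝ}
    (hM : ∀ i j, AEStronglyMeasurable (fun t => M t i j) μ) : AEStronglyMeasurable M μ := by
  have h : AEMeasurable (β := ι → κ → ℝ) M μ :=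
    aemeasurable_pi_lambda _ fun i => aemeasurable_pi_lambda _ fun j => (hM i j).aemeasurable
  exact h.aestronglyMeasurable

/-- By Cramer's rule the inverse is `det⁻¹` times the adjugate. Inversion on `ℝ` is total and
measurable, so no invertibility is required. -/
theorem aestronglyMeasurable_matrix_inv {ι : Type*} [Fintype ι] [DecidableEq ι] {μ : Measure ℝ}
    {M : ℝ → Matrix ι ι ℝ} (hM : AEStronglyMeasurable M μ) (i j : ι) :
    AEStronglyMeasurable (fun t => (M t)⁻¹ i j) μ := by
  simp only [Matrix.inv_def, Matrix.smul_apply, smul_eq_mul, Ring.inverse_eq_inv']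
  have hdet : AEStronglyMeasurable (fun t => (M t).det) μ :=
    (continuous_id.matrix_det).comp_aestronglyMeasurable hM
  have hadj : AEStronglyMeasurable (fun t => (M t).adjugate i j) μ :=
    Continuous.comp_aestronglyMeasurable
      (g := fun M : Matrix ι ι ℝ => M.adjugate i j)
      ((continuous_id.matrix_adjugate).matrix_elem i j) hM
  exact hdet.aemeasurable.inv.aestronglyMeasurable.mul hadj

section Coercive

variable {m : ℕ} {ρ : ℝ} {R : Matrix (Fin m) (Fin m) ℝ}

theorem Matrix.PosSemidef.coercive (h : (R - ρ • (1 : Matrix (Fin m) (Fin m) ℝ)).PosSemidef)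
    (u : Fin m → ℝ) : ρ * (u ⬝ᵥ u) ≤ u ⬝ᵥ (R *ᵥ u) := by
  have := h.dotProduct_mulVec_nonneg u
  rw [Matrix.sub_mulVec, Matrix.smul_mulVec, Matrix.one_mulVec, dotProduct_sub, dotProduct_smul,
    star_trivial, smul_eq_mul] at this
  linarith

theorem Matrix.PosSemidef.isSymm_of_sub_smul_one
    (h : (R - ρ • (1 : Matrix (Fin m) (Fin m) ℝ)).PosSemidef) : R.IsSymm := by
  have := h.isHermitian
  rw [Matrix.IsHermitian, Matrix.conjTranspose_eq_transpose_of_trivial, Matrix.transpose_sub,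
    Matrix.transpose_smul, Matrix.transpose_one] at this
  exact sub_left_injective this

theorem Matrix.PosSemidef.isUnit_det_of_sub_smul_one (hρ : 0 < ρ)
    (h : (R - ρ • (1 : Matrix (Fin m) (Fin m) ℝ)).PosSemidef) : IsUnit R.det := by
  rw [isUnit_iff_ne_zero]
  intro h0
  obtain ⟨v, hv, hRv⟩ := Matrix.exists_mulVec_eq_zero_iff.2 h0
  have := h.coercive v
  rw [hRv, dotProduct_zero] at this
  have hv' : 0 < v ⬝ᵥ v := by simpa using Matrix.dotProduct_star_self_pos_iff.2 hv
  nlinarith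

/-- The `j`-th column `u` of `R⁻¹` satisfies `R u = e_j`, so coercivity gives `ρ |u|² ≤ u_j`. The
`j`-th coordinate yields `ρ u_j ≤ 1`, and then `(ρ u_i)² ≤ ρ u_j ≤ 1`. -/
theorem Matrix.PosSemidef.abs_inv_le (hρ : 0 < ρ)
    (h : (R - ρ • (1 : Matrix (Fin m) (Fin m) ℝ)).PosSemidef) (i j : Fin m) :
    |R⁻¹ i j| ≤ ρ⁻¹ := by
  have hu := h.isUnit_det_of_sub_smul_one hρ
  set u : Fin m → ℝ := fun i => R⁻¹ i j
  have hRu : R *ᵥ u = Pi.single j 1 := by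
    have : u = R⁻¹ *ᵥ Pi.single j 1 := by ext; simp [u]
    rw [this, Matrix.mulVec_mulVec, Matrix.mul_nonsing_inv _ hu, Matrix.one_mulVec]
  have h1 := h.coercive u
  rw [hRu, dotProduct_single, mul_one] at h1
  have h2 : ∀ k, u k ^ 2 ≤ u ⬝ᵥ u := fun k => by
    rw [sq]
    exact Finset.single_le_sum (f := fun k => u k * u k) (fun i _ => mul_self_nonneg _)
      (Finset.mem_univ k)
  have hj : ρ * u j ^ 2 ≤ u j := (mul_le_mul_of_nonneg_left (h2 j) hρ.le).trans h1
  have hi : ρ * u i ^ 2 ≤ u j := (mul_le_mul_of_nonneg_left (h2 i) hρ.le).trans h1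
  have hj' : ρ * u j ≤ 1 := by
    by_contra! hc
    have : 0 < u j := by by_contra! h0; nlinarith
    nlinarith
  have : (ρ * u i) ^ 2 ≤ 1 := by nlinarith
  rw [sq_le_one_iff_abs_le_one, abs_mul, abs_of_pos hρ] at this
  rwa [inv_eq_one_div ρ, le_div_iff₀' hρ]

end Coercive

/-- The standing assumptions on the data of a linear-quadratic problem. -/
structure LQProblem.IsRegular {n m : ℕ} (P : LQProblem n m) : Prop where
  horizon_pos : 0 < P.T
  bdd_A : IsBoundedMatrixFun P.T P.A
  bdd_B : IsBoundedMatrixFun P.T P.B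
  bdd_Q : IsBoundedMatrixFun P.T P.Q
  bdd_N : IsBoundedMatrixFun P.T P.N
  bdd_R : IsBoundedMatrixFun P.T P.R
  symm_Q : ∀ᵐ t ∂(volume.restrict (Icc 0 P.T)), (P.Q t).IsSymm
  coercive : ∃ ρ : ℝ, 0 < ρ ∧ ∀ᵐ t ∂(volume.restrict (Icc 0 P.T)),
    (P.R t - ρ • (1 : Matrix (Fin m) (Fin m) ℝ)).PosSemidef

theorem ae_restrict_Icc_mono {p : ℝ → Prop} {a b c d : ℝ} (hc : a ≤ c) (hd : d ≤ b)
    (h : ∀ᵐ t ∂(volume.restrict (Icc a b)), p t) : ∀ᵐ t ∂(volume.restrict (Icc c d)), p t :=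
  ae_restrict_of_ae_restrict_of_subset (Icc_subset_Icc hc hd) h

namespace LQProblem

variable {n m : ℕ} {P : LQProblem n m}

namespace IsRegular

theorem ae_R (h : P.IsRegular) : ∀ᵐ t ∂(volume.restrict (Icc 0 P.T)),
    (P.R t).IsSymm ∧ IsUnit (P.R t).det := by
  obtain ⟨ρ, hρ, hR⟩ := h.coercive
  filter_upwards [hR] with t ht
  exact ⟨ht.isSymm_of_sub_smul_one, ht.isUnit_det_of_sub_smul_one hρ⟩

theorem bdd_R_inv (h : P.IsRegular) :
    MatrixMemLp (fun t => (P.R t)⁻¹) ⊤ (volume.restrict (Icc 0 P.T)) := by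
  obtain ⟨ρ, hρ, hR⟩ := h.coercive
  intro i j
  refine memLp_top_of_bound (aestronglyMeasurable_matrix_inv
    (aestronglyMeasurable_matrix fun i j => (h.bdd_R i j).1) i j) ρ⁻¹ ?_
  filter_upwards [hR] with t ht using ht.abs_inv_le hρ i j

end IsRegular

/-! ### The Hamiltonian system -/

variable (P)

/-- The state block `A - B R⁻¹ Nᵀ` of the Hamiltonian. -/
noncomputable def hamA (t : ℝ) : Matrix (Fin n) (Fin n) ℝ :=
  P.A t - P.B t * (P.R t)⁻¹ * (P.N t)ᵀ

/-- The block `B R⁻¹ Bᵀ` of the Hamiltonian. -/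
noncomputable def hamG (t : ℝ) : Matrix (Fin n) (Fin n) ℝ :=
  P.B t * (P.R t)⁻¹ * (P.B t)ᵀ

/-- The block `N R⁻¹ Nᵀ - Q` of the Hamiltonian. -/
noncomputable def hamQ (t : ℝ) : Matrix (Fin n) (Fin n) ℝ :=
  P.N t * (P.R t)⁻¹ * (P.N t)ᵀ - P.Q t

/-- The Hamiltonian matrix of the optimality system of state and costate. -/
noncomputable def hamiltonian (t : ℝ) : Matrix (Fin n ⊕ Fin n) (Fin n ⊕ Fin n) ℝ :=
  Matrix.fromBlocks (P.hamA t) (-P.hamG t) (P.hamQ t) (-(P.hamA t)ᵀ)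

/-- The pair `(X, Y)` is a matrix solution on `[a, b]` of the Hamiltonian system. -/
def IsHamiltonianSolution {κ : Type*} (X Y : ℝ → Matrix (Fin n) κ ℝ) (a b : ℝ) : Prop :=
  IsMatrixPrimitiveOn X (fun t => P.hamA t * X t - P.hamG t * Y t) a b ∧
  IsMatrixPrimitiveOn Y (fun t => P.hamQ t * X t - (P.hamA t)ᵀ * Y t) a b

/-- The pair `(X, Y)` is the solution of the Hamiltonian system on `[0, T]` with terminal value
`(1, 0)`. -/
structure IsTerminalSolution (X Y : ℝ → Matrix (Fin n) (Fin n) ℝ) : Prop where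
  sol : P.IsHamiltonianSolution X Y 0 P.T
  left : X P.T = 1
  right : Y P.T = 0

variable {P}

theorem IsRegular.bdd_hamA (h : P.IsRegular) :
    MatrixMemLp P.hamA ⊤ (volume.restrict (Icc 0 P.T)) :=
  MatrixMemLp.sub h.bdd_A
    ((MatrixMemLp.mul h.bdd_B h.bdd_R_inv).mul (MatrixMemLp.transpose h.bdd_N))

theorem IsRegular.bdd_hamG (h : P.IsRegular) :
    MatrixMemLp P.hamG ⊤ (volume.restrict (Icc 0 P.T)) :=
  (MatrixMemLp.mul h.bdd_B h.bdd_R_inv).mul (MatrixMemLp.transpose h.bdd_B)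

theorem IsRegular.bdd_hamQ (h : P.IsRegular) :
    MatrixMemLp P.hamQ ⊤ (volume.restrict (Icc 0 P.T)) :=
  MatrixMemLp.sub
    ((MatrixMemLp.mul h.bdd_N h.bdd_R_inv).mul (MatrixMemLp.transpose h.bdd_N)) h.bdd_Q

theorem IsRegular.bdd_hamiltonian (h : P.IsRegular) :
    MatrixMemLp P.hamiltonian ⊤ (volume.restrict (Icc 0 P.T)) :=
  h.bdd_hamA.fromBlocks h.bdd_hamG.neg h.bdd_hamQ h.bdd_hamA.transpose.neg

theorem IsHamiltonianSolution.mono {κ : Type*} {X Y : ℝ → Matrix (Fin n) κ ℝ} {a b c d : ℝ}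
    (h : P.IsHamiltonianSolution X Y a b) (hc : a ≤ c) (hd : d ≤ b) :
    P.IsHamiltonianSolution X Y c d := ⟨h.1.mono hc hd, h.2.mono hc hd⟩

theorem IsRegular.exists_terminalSolution (h : P.IsRegular) :
    ∃ X Y, P.IsTerminalSolution X Y := by
  obtain ⟨F, hF₀, hF⟩ := exists_matrix_ode_solution h.bdd_hamiltonian
    (right_mem_Icc.2 h.horizon_pos.le) (Matrix.fromRows (1 : Matrix (Fin n) (Fin n) ℝ) 0)
  refine ⟨fun t => (F t).toRows₁, fun t => (F t).toRows₂, ⟨fun i j => ?_, fun i j => ?_⟩, ?_, ?_⟩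
  · refine (hF (Sum.inl i) j).congr (fun _ _ => rfl) (Eventually.of_forall fun t => ?_)
    simp [hamiltonian, Matrix.mul_apply, sub_eq_add_neg]
  · refine (hF (Sum.inr i) j).congr (fun _ _ => rfl) (Eventually.of_forall fun t => ?_)
    simp [hamiltonian, Matrix.mul_apply, sub_eq_add_neg]
  · simp [hF₀]
  · simp [hF₀]

/-- A solution of the Hamiltonian system that vanishes at one time vanishes identically. -/
theorem IsRegular.hamiltonian_eq_zero (h : P.IsRegular) {a b t₀ : ℝ} (ha : 0 ≤ a) (hb : b ≤ P.T)
    (ht₀ : t₀ ∈ Icc a b) {x l : ℝ → Fin n → ℝ}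
    (hx : IsVectorPrimitiveOn x (fun t => P.hamA t *ᵥ x t - P.hamG t *ᵥ l t) a b)
    (hl : IsVectorPrimitiveOn l (fun t => P.hamQ t *ᵥ x t - (P.hamA t)ᵀ *ᵥ l t) a b)
    (hx₀ : x t₀ = 0) (hl₀ : l t₀ = 0) : ∀ t ∈ Icc a b, x t = 0 ∧ l t = 0 := by
  have key := linear_ode_eq_zero (h.bdd_hamiltonian.mono ha hb) ht₀
    (y := fun t => Sum.elim (x t) (l t)) ?_ ?_
  · intro t ht
    have := key t ht
    exact ⟨funext fun i => congrFun this (Sum.inl i), funext fun i => congrFun this (Sum.inr i)⟩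
  · rintro (i | i)
    · refine (hx i).congr (fun _ _ => rfl) (Eventually.of_forall fun t => ?_)
      simp [hamiltonian, Matrix.fromBlocks_mulVec, sub_eq_add_neg, Matrix.neg_mulVec]
    · refine (hl i).congr (fun _ _ => rfl) (Eventually.of_forall fun t => ?_)
      simp [hamiltonian, Matrix.fromBlocks_mulVec, sub_eq_add_neg, Matrix.neg_mulVec]
  · ext (i | i) <;> simp [hx₀, hl₀]

theorem IsHamiltonianSolution.mulVec {κ : Type*} [Fintype κ] {X Y : ℝ → Matrix (Fin n) κ ℝ}
    {a b : ℝ} (h : P.IsHamiltonianSolution X Y a b) (ξ : κ → ℝ) :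
    IsVectorPrimitiveOn (fun t => X t *ᵥ ξ)
      (fun t => P.hamA t *ᵥ (X t *ᵥ ξ) - P.hamG t *ᵥ (Y t *ᵥ ξ)) a b ∧
    IsVectorPrimitiveOn (fun t => Y t *ᵥ ξ)
      (fun t => P.hamQ t *ᵥ (X t *ᵥ ξ) - (P.hamA t)ᵀ *ᵥ (Y t *ᵥ ξ)) a b := by
  refine ⟨(h.1.mulVec_const ξ).congr_deriv ?_, (h.2.mulVec_const ξ).congr_deriv ?_⟩ <;>
  exact Eventually.of_forall fun t => by simp [Matrix.sub_mulVec, Matrix.mulVec_mulVec]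

/-- A nonzero solution `(X ξ, Y ξ)` never vanishes. -/
theorem IsTerminalSolution.eq_zero (h : P.IsRegular) {X Y : ℝ → Matrix (Fin n) (Fin n) ℝ}
    (hXY : P.IsTerminalSolution X Y) {t : ℝ} (ht : t ∈ Icc 0 P.T) {ξ : Fin n → ℝ}
    (hX : X t *ᵥ ξ = 0) (hY : Y t *ᵥ ξ = 0) : ξ = 0 := by
  have := (h.hamiltonian_eq_zero le_rfl le_rfl ht (hXY.sol.mulVec ξ).1 (hXY.sol.mulVec ξ).2 hX hY
    P.T (right_mem_Icc.2 h.horizon_pos.le)).1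
  simpa [hXY.left] using this

/-- Supplies the direction `ξ` and the nonzero costate `Y(t) ξ` on which all arguments about
singular `X` rest. -/
theorem IsTerminalSolution.exists_kernel (h : P.IsRegular) {X Y : ℝ → Matrix (Fin n) (Fin n) ℝ}
    (hXY : P.IsTerminalSolution X Y) {t : ℝ} (ht : t ∈ Icc 0 P.T) (hX : ¬ IsUnit (X t).det) :
    ∃ ξ, ξ ≠ 0 ∧ X t *ᵥ ξ = 0 ∧ Y t *ᵥ ξ ≠ 0 := by
  rw [isUnit_iff_ne_zero, not_not] at hX
  obtain ⟨ξ, hξ, hXξ⟩ := Matrix.exists_mulVec_eq_zero_iff.2 hX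
  exact ⟨ξ, hξ, hXξ, fun hY => hξ (hXY.eq_zero h ht hXξ hY)⟩

theorem IsRegular.symm_ham (h : P.IsRegular) : ∀ᵐ t ∂(volume.restrict (Icc 0 P.T)),
    (P.hamG t).IsSymm ∧ (P.hamQ t).IsSymm := by
  filter_upwards [h.ae_R, h.symm_Q] with t hR hQ
  have hRi : ((P.R t)⁻¹)ᵀ = (P.R t)⁻¹ := by rw [Matrix.transpose_nonsing_inv, hR.1]
  constructor
  · simp [hamG, Matrix.IsSymm, Matrix.transpose_mul, hRi, Matrix.mul_assoc]
  · simp [hamQ, Matrix.IsSymm, Matrix.transpose_mul, hRi, Matrix.mul_assoc, hQ.eq]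

/-- The symplectic form `Xᵀ Y - Yᵀ X` is conserved by the Hamiltonian flow and vanishes at `T`. This
is what makes `Y X⁻¹` symmetric. -/
theorem IsTerminalSolution.transpose_mul_isSymm (h : P.IsRegular)
    {X Y : ℝ → Matrix (Fin n) (Fin n) ℝ} (hXY : P.IsTerminalSolution X Y) {t : ℝ}
    (ht : t ∈ Icc 0 P.T) : ((X t)ᵀ * Y t).IsSymm := by
  have h1 := hXY.sol.1.transpose.mul hXY.sol.2
  have h2 := (h1.sub h1.transpose).eq_of_deriv_zero ?_ ht (right_mem_Icc.2 h.horizon_pos.le)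
  · rw [hXY.right, Matrix.mul_zero, Matrix.transpose_zero, sub_zero, sub_eq_zero] at h2
    exact h2.symm
  · filter_upwards [h.symm_ham] with s hs
    simp only [Matrix.transpose_sub, Matrix.transpose_add, Matrix.transpose_mul,
      Matrix.transpose_transpose, hs.1.eq, hs.2.eq, Matrix.sub_mul, Matrix.mul_sub,
      Matrix.mul_assoc]
    abel

/-! ### Riccati solutions, invertibility of `X` and finite escape. -/

/-- The Riccati equation in terms of the blocks of the Hamiltonian. -/
theorem riccati_iff {t : ℝ} (hR : (P.R t).IsSymm) {L D : Matrix (Fin n) (Fin n) ℝ}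
    (hL : L.IsSymm) :
    P.Q t + D + (P.A t)ᵀ * L + L * P.A t
        - (P.N t + L * P.B t) * (P.R t)⁻¹ * (P.N t + L * P.B t)ᵀ = 0 ↔
      D = P.hamQ t - (P.hamA t)ᵀ * L - L * (P.hamA t) + L * P.hamG t * L := by
  have hRi : ((P.R t)⁻¹)ᵀ = (P.R t)⁻¹ := by rw [Matrix.transpose_nonsing_inv, hR]
  rw [← sub_eq_zero (a := D)]
  have : P.Q t + D + (P.A t)ᵀ * L + L * P.A t
        - (P.N t + L * P.B t) * (P.R t)⁻¹ * (P.N t + L * P.B t)ᵀ =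
      D - (P.hamQ t - (P.hamA t)ᵀ * L - L * (P.hamA t) + L * P.hamG t * L) := by
    simp only [hamQ, hamA, hamG, Matrix.transpose_sub, Matrix.transpose_add, Matrix.transpose_mul,
      Matrix.transpose_transpose, hRi, hL.eq, Matrix.sub_mul, Matrix.mul_sub, Matrix.add_mul,
      Matrix.mul_add, Matrix.mul_assoc]
    abel
  rw [this]

theorem HasDerivFinalZero.isMatrixPrimitiveOn {a : ℝ} {L D : ℝ → Matrix (Fin n) (Fin n) ℝ}
    (h : P.HasDerivFinalZero a L D) (ha : a ≤ P.T) : IsMatrixPrimitiveOn L D a P.T := by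
  intro i j
  have hT : L P.T i j = 0 := by simpa using h.2.1 P.T (right_mem_Icc.2 ha) i j
  refine IsPrimitiveOn.of_base (t₀ := P.T)
    ((intervalIntegrable_iff_integrableOn_Icc_of_le ha).1 (h.1 i j)) (right_mem_Icc.2 ha)
    fun t ht => ?_
  rw [hT, h.2.1 t ht i j, intervalIntegral.integral_symm t P.T]
  simp

theorem HasDerivFinalZero.apply_horizon {a : ℝ} {L D : ℝ → Matrix (Fin n) (Fin n) ℝ}
    (h : P.HasDerivFinalZero a L D) (ha : a ≤ P.T) : L P.T = 0 := by
  ext i j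
  simpa using h.2.1 P.T (right_mem_Icc.2 ha) i j

theorem hasDerivFinalZero_of_isMatrixPrimitiveOn {a : ℝ} {L D : ℝ → Matrix (Fin n) (Fin n) ℝ}
    (h : IsMatrixPrimitiveOn L D a P.T) (ha : a ≤ P.T) (hT : L P.T = 0)
    (hs : ∀ t ∈ Icc a P.T, (L t).IsSymm) : P.HasDerivFinalZero a L D := by
  refine ⟨fun i j => (intervalIntegrable_iff_integrableOn_Icc_of_le ha).2 (h i j).1,
    fun t ht i j => ?_, hs⟩
  rw [← (h i j).sub_eq ht (right_mem_Icc.2 ha), hT]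
  simp

/-- Where `X` is invertible, `Y X⁻¹` solves the Riccati equation. -/
theorem IsTerminalSolution.isDRESolution (h : P.IsRegular) {X Y : ℝ → Matrix (Fin n) (Fin n) ℝ}
    (hXY : P.IsTerminalSolution X Y) {a : ℝ} (ha : a ∈ Icc 0 P.T)
    (hX : ∀ t ∈ Icc a P.T, IsUnit (X t).det) :
    P.IsDRESolution a (fun t => Y t * (X t)⁻¹) := by
  have haT : P.T ∈ Icc a P.T := right_mem_Icc.2 ha.2
  have hsol := hXY.sol.mono ha.1 le_rfl
  have hsymm : ∀ t ∈ Icc a P.T, (Y t * (X t)⁻¹).IsSymm := by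
    intro t ht
    have h1 := (hXY.transpose_mul_isSymm h ⟨ha.1.trans ht.1, ht.2⟩).eq
    rw [Matrix.transpose_mul, Matrix.transpose_transpose] at h1
    have hu := hX t ht
    have hu' : IsUnit ((X t)ᵀ).det := by rwa [Matrix.det_transpose]
    rw [Matrix.IsSymm, Matrix.transpose_mul, Matrix.transpose_nonsing_inv]
    calc ((X t)ᵀ)⁻¹ * (Y t)ᵀ = ((X t)ᵀ)⁻¹ * ((Y t)ᵀ * X t) * (X t)⁻¹ := by
          rw [← Matrix.mul_assoc, Matrix.mul_assoc _ (X t), Matrix.mul_nonsing_inv _ hu,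
            Matrix.mul_one]
      _ = Y t * (X t)⁻¹ := by
          rw [h1, ← Matrix.mul_assoc, Matrix.nonsing_inv_mul _ hu', Matrix.one_mul]
  set L : ℝ → Matrix (Fin n) (Fin n) ℝ := fun t => Y t * (X t)⁻¹ with hL
  have hYL : ∀ t ∈ Icc a P.T, L t * X t = Y t := fun t ht => by
    rw [hL, Matrix.mul_assoc, Matrix.nonsing_inv_mul _ (hX t ht), Matrix.mul_one]
  have hcont : ∀ i j, ContinuousOn (fun t => L t i j) (Icc a P.T) := by
    intro i j t ht
    have hXc : ContinuousWithinAt X (Icc a P.T) t := hsol.1.continuousOn t ht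
    have hYc : ContinuousWithinAt Y (Icc a P.T) t := hsol.2.continuousOn t ht
    have hd : ContinuousAt Ring.inverse (X t).det := by
      rw [Ring.inverse_eq_inv']
      exact continuousAt_inv₀ (hX t ht).ne_zero
    have hinv : ContinuousWithinAt (fun t => (X t)⁻¹) (Icc a P.T) t :=
      (continuousAt_matrix_inv (X t) hd).comp_continuousWithinAt hXc
    exact ((continuous_id.matrix_elem i j).continuousAt).comp_continuousWithinAt (hYc.mul hinv)
  have hLb : MatrixMemLp L ⊤ (volume.restrict (Icc a P.T)) := MatrixMemLp.of_continuousOn hcont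
  -- Here `X' = K X`. Absolute continuity of `X⁻¹` comes from solving `Z' = -Z K`, `Z(T) = 1`, in
  -- transposed form `W = Zᵀ`: the product `Z X` has zero derivative, hence `Z = X⁻¹`.
  set K : ℝ → Matrix (Fin n) (Fin n) ℝ := fun t => P.hamA t - P.hamG t * L t with hK
  have hKb : MatrixMemLp K ⊤ (volume.restrict (Icc a P.T)) :=
    (h.bdd_hamA.mono ha.1 le_rfl).sub ((h.bdd_hamG.mono ha.1 le_rfl).mul hLb)
  obtain ⟨W, hW₀, hW⟩ := exists_matrix_ode_solution hKb.transpose.neg haT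
    (1 : Matrix (Fin n) (Fin n) ℝ)
  have hZ := hW.transpose
  have hZX : ∀ t ∈ Icc a P.T, (W t)ᵀ = (X t)⁻¹ := by
    intro t ht
    have h1 := (hZ.mul hsol.1).eq_of_deriv_zero ?_ ht haT
    · rw [hW₀, hXY.left, Matrix.transpose_one, Matrix.mul_one] at h1
      exact (Matrix.inv_eq_left_inv h1).symm
    · filter_upwards [ae_restrict_mem measurableSet_Icc] with s hs
      rw [← hYL s hs]
      simp only [hK, Matrix.transpose_mul, Matrix.transpose_neg, Matrix.transpose_sub,
        Matrix.transpose_transpose, Matrix.neg_mul, Matrix.mul_sub, Matrix.sub_mul, Matrix.mul_assoc]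
      abel
  have hprim : IsMatrixPrimitiveOn L (fun t => P.hamQ t - (P.hamA t)ᵀ * L t - L t * P.hamA t
      + L t * P.hamG t * L t) a P.T := by
    refine (hsol.2.mul hZ).congr (fun t ht => by rw [hZX t ht]) ?_
    filter_upwards [ae_restrict_mem measurableSet_Icc] with s hs
    have hu : X s * (X s)⁻¹ = 1 := Matrix.mul_nonsing_inv _ (hX s hs)
    simp only [Matrix.transpose_mul, Matrix.transpose_neg, Matrix.transpose_transpose, hZX s hs,
      Matrix.sub_mul, Matrix.mul_assoc, hu, Matrix.mul_one, hK, hL, Matrix.neg_mul,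
      Matrix.mul_neg, Matrix.mul_sub]
    abel
  refine ⟨_, hasDerivFinalZero_of_isMatrixPrimitiveOn hprim ha.2 ?_ hsymm, ?_⟩
  · simp [hL, hXY.right]
  · filter_upwards [ae_restrict_mem measurableSet_Icc,
      ae_restrict_Icc_mono ha.1 le_rfl h.ae_R] with t ht hR
    exact (riccati_iff hR.1 (hsymm t ht)).2 rfl

/-- A Riccati solution `L` on `[a, T]` satisfies `Y = L X` there, and `X` is invertible. -/
theorem IsDRESolution.terminalSolution (h : P.IsRegular) {X Y : ℝ → Matrix (Fin n) (Fin n) ℝ}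
    (hXY : P.IsTerminalSolution X Y) {a : ℝ} (ha : a ∈ Icc 0 P.T)
    {L : ℝ → Matrix (Fin n) (Fin n) ℝ} (hL : P.IsDRESolution a L) :
    ∀ t ∈ Icc a P.T, Y t = L t * X t ∧ IsUnit (X t).det := by
  obtain ⟨D, hD, hric⟩ := hL
  have haT : P.T ∈ Icc a P.T := right_mem_Icc.2 ha.2
  have hLp := hD.isMatrixPrimitiveOn ha.2
  have hsol := hXY.sol.mono ha.1 le_rfl
  have hE : ∀ t ∈ Icc a P.T, Y t - L t * X t = 0 := by
    -- By the Riccati equation the defect `Y - L X` obeys a homogeneous linear equation, and it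
    -- vanishes at `T`.
    refine matrix_ode_eq_zero (M := fun t => -(P.hamA t)ᵀ + L t * P.hamG t)
      ((h.bdd_hamA.mono ha.1 le_rfl).transpose.neg.add
        (hLp.memLp_top.mul (h.bdd_hamG.mono ha.1 le_rfl))) haT
      ((hsol.2.sub (hLp.mul hsol.1)).congr_deriv ?_) ?_
    · filter_upwards [hric, ae_restrict_mem measurableSet_Icc,
        ae_restrict_Icc_mono ha.1 le_rfl h.ae_R] with t h1 ht hR
      rw [(riccati_iff hR.1 (hD.2.2 t ht)).1 h1]
      simp only [Matrix.add_mul, Matrix.sub_mul, Matrix.mul_sub, Matrix.neg_mul, Matrix.mul_assoc]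
      abel
    · simp [hD.apply_horizon ha.2, hXY.right]
  intro t ht
  have hYt := sub_eq_zero.1 (hE t ht)
  refine ⟨hYt, ?_⟩
  by_contra hu
  obtain ⟨ξ, -, hX, hY⟩ := hXY.exists_kernel h ⟨ha.1.trans ht.1, ht.2⟩ hu
  exact hY (by rw [hYt, ← Matrix.mulVec_mulVec, hX, Matrix.mulVec_zero])

theorem IsTerminalSolution.continuousWithinAt_Ioi (hXY : P.IsTerminalSolution X Y)
    {τ : ℝ} (hτ : τ ∈ Ico 0 P.T) : Tendsto X (𝓝[>] τ) (𝓝 (X τ)) ∧ Tendsto Y (𝓝[>] τ) (𝓝 (Y τ)) := by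
  have hle : 𝓝[>] τ ≤ 𝓝[Icc 0 P.T] τ := nhdsWithin_le_of_mem (Icc_mem_nhdsGT_of_mem hτ)
  exact ⟨(hXY.sol.1.continuousOn τ ⟨hτ.1, hτ.2.le⟩).mono_left hle,
    (hXY.sol.2.continuousOn τ ⟨hτ.1, hτ.2.le⟩).mono_left hle⟩

/-- Were `X(τ)` invertible, the solution `Y X⁻¹` would have the finite limit `Y(τ) X(τ)⁻¹` at `τ`.
-/
theorem DREEscapesAt.not_isUnit_det (h : P.IsRegular) {X Y : ℝ → Matrix (Fin n) (Fin n) ℝ}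
    (hXY : P.IsTerminalSolution X Y) {τ : ℝ} (hτ : P.DREEscapesAt τ) : ¬ IsUnit (X τ).det := by
  obtain ⟨hτT, L, hL, hlim⟩ := hτ
  intro hu
  have hLeq : ∀ t ∈ Ioc τ P.T, L t = Y t * (X t)⁻¹ := by
    intro t ht
    obtain ⟨h1, h2⟩ := (hL t ht).terminalSolution h hXY ⟨hτT.1.trans ht.1.le, ht.2⟩ t
      ⟨le_rfl, ht.2⟩
    rw [h1, Matrix.mul_assoc, Matrix.mul_nonsing_inv _ h2, Matrix.mul_one]
  obtain ⟨hX, hY⟩ := hXY.continuousWithinAt_Ioi hτT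
  have hd : ContinuousAt Ring.inverse (X τ).det := by
    rw [Ring.inverse_eq_inv']
    exact continuousAt_inv₀ hu.ne_zero
  have hlim' : Tendsto (fun t => Y t * (X t)⁻¹) (𝓝[>] τ) (𝓝 (Y τ * (X τ)⁻¹)) :=
    hY.mul ((continuousAt_matrix_inv (X τ) hd).tendsto.comp hX)
  have hev : (fun t => Y t * (X t)⁻¹) =ᶠ[𝓝[>] τ] L := by
    filter_upwards [Ioc_mem_nhdsGT hτT.2] with t ht using (hLeq t ht).symm
  have hL' := hlim'.congr' hev
  refine not_tendsto_nhds_of_tendsto_atTop hlim (∑ i, ∑ j, ((Y τ * (X τ)⁻¹) i j) ^ 2) ?_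
  exact tendsto_finsetSum _ fun i _ => tendsto_finsetSum _ fun j _ =>
    ((tendsto_pi_nhds.1 (tendsto_pi_nhds.1 hL' i) j).pow 2)

/-- If `X` is singular somewhere, then the Riccati equation escapes to infinity. -/
theorem IsTerminalSolution.exists_escape (h : P.IsRegular) {X Y : ℝ → Matrix (Fin n) (Fin n) ℝ}
    (hXY : P.IsTerminalSolution X Y) (hX : ∃ t ∈ Icc 0 P.T, ¬ IsUnit (X t).det) :
    ∃ τ, P.DREEscapesAt τ := by
  have hdet : ContinuousOn (fun t => (X t).det) (Icc 0 P.T) :=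
    (continuous_id.matrix_det).comp_continuousOn hXY.sol.1.continuousOn
  -- The escape time is the last zero of `det X`. It is attained by compactness and lies before `T`
  -- because `X(T) = 1`.
  set S := Icc 0 P.T ∩ (fun t => (X t).det) ⁻¹' {0}
  have hS : IsCompact S :=
    isCompact_Icc.of_isClosed_subset
      (hdet.preimage_isClosed_of_isClosed isClosed_Icc isClosed_singleton) inter_subset_left
  have hne : S.Nonempty := by
    obtain ⟨t, ht, hu⟩ := hX
    exact ⟨t, ht, by simpa [isUnit_iff_ne_zero] using hu⟩
  obtain ⟨τ, hτS, hmax⟩ := hS.exists_isGreatest hne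
  have hτT : τ ∈ Ico 0 P.T := by
    refine ⟨hτS.1.1, lt_of_le_of_ne hτS.1.2 fun heq => ?_⟩
    have : (X τ).det = 0 := hτS.2
    rw [heq, hXY.left, Matrix.det_one] at this
    exact one_ne_zero this
  have hunit : ∀ t ∈ Ioc τ P.T, IsUnit (X t).det := by
    intro t ht
    rw [isUnit_iff_ne_zero]
    exact fun h0 => not_lt.2 (hmax ⟨⟨hτT.1.trans ht.1.le, ht.2⟩, h0⟩) ht.1
  refine ⟨τ, hτT, fun t => Y t * (X t)⁻¹, fun a ha => hXY.isDRESolution h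
    ⟨hτT.1.trans ha.1.le, ha.2⟩ fun t ht => hunit t ⟨ha.1.trans_le ht.1, ht.2⟩, ?_⟩
  -- Otherwise the squared norm is below some `C` at times arbitrarily close to `τ`. There `|(Y
  -- ξ)_i| ≤ √C ∑ |(X ξ)_j|`, and in the limit `X(τ) ξ = 0` forces `Y(τ) ξ = 0`.
  by_contra hnot
  rw [tendsto_atTop] at hnot
  push Not at hnot
  obtain ⟨C, hC⟩ := hnot
  obtain ⟨ξ, -, hXξ, hYξ⟩ := hXY.exists_kernel h ⟨hτT.1, hτT.2.le⟩
    (by simpa [isUnit_iff_ne_zero] using hτS.2)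
  obtain ⟨hXlim, hYlim⟩ := hXY.continuousWithinAt_Ioi hτT
  have hmv : Continuous fun M : Matrix (Fin n) (Fin n) ℝ => M *ᵥ ξ :=
    continuous_id.matrix_mulVec continuous_const
  apply hYξ
  ext i
  have hle : |(Y τ *ᵥ ξ) i| ≤ 0 := by
    have h1 : Tendsto (fun t => |(Y t *ᵥ ξ) i| - √C * ∑ j, |(X t *ᵥ ξ) j|) (𝓝[>] τ)
        (𝓝 (|(Y τ *ᵥ ξ) i| - √C * ∑ j, |(X τ *ᵥ ξ) j|)) := by
      have hY' := tendsto_pi_nhds.1 ((hmv.tendsto _).comp hYlim) i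
      have hX' := fun j => tendsto_pi_nhds.1 ((hmv.tendsto _).comp hXlim) j
      exact hY'.abs.sub ((tendsto_finsetSum _ fun j _ => (hX' j).abs).const_mul _)
    have h2 := le_of_tendsto_of_frequently (b := 0) h1 ?_
    · simpa [hXξ] using h2
    · refine (hC.and_eventually (Ioc_mem_nhdsGT hτT.2)).mono ?_
      rintro t ⟨hlt, ht⟩
      have hY' : Y t *ᵥ ξ = (Y t * (X t)⁻¹) *ᵥ (X t *ᵥ ξ) := by
        rw [Matrix.mulVec_mulVec, Matrix.mul_assoc, Matrix.nonsing_inv_mul _ (hunit t ht),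
          Matrix.mul_one]
      rw [sub_nonpos, hY', Finset.mul_sum]
      change |∑ j, (Y t * (X t)⁻¹) i j * (X t *ᵥ ξ) j| ≤ _
      refine (Finset.abs_sum_le_sum_abs _ _).trans (Finset.sum_le_sum fun j _ => ?_)
      rw [abs_mul]
      gcongr
      apply Real.abs_le_sqrt
      refine le_trans ?_ hlt.le
      exact (Finset.single_le_sum (f := fun j => ((Y t * (X t)⁻¹) i j) ^ 2)
        (fun j _ => sq_nonneg _) (Finset.mem_univ j)).trans
        (Finset.single_le_sum (f := fun i => ∑ j, ((Y t * (X t)⁻¹) i j) ^ 2)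
          (fun i _ => Finset.sum_nonneg fun j _ => sq_nonneg _) (Finset.mem_univ i))
  simpa using hle

end LQProblem

namespace LQProblem

variable {n m : ℕ} {P : LQProblem n m}

/-! ### Trajectories -/

theorem IsRegular.memLp_vectorField (h : P.IsRegular) {a b : ℝ} (ha : 0 ≤ a) (hb : b ≤ P.T)
    {x : ℝ → Fin n → ℝ} {v : ℝ → Fin m → ℝ} (hx : ContinuousOn x (Icc a b))
    (hv : MemLp v 2 (volume.restrict (Icc a b))) (i : Fin n) :
    MemLp (fun t => (P.A t *ᵥ x t + P.B t *ᵥ v t) i) 2 (volume.restrict (Icc a b)) :=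
  ((MatrixMemLp.mono h.bdd_A ha hb).mulVec
    (fun j => (continuousOn_pi.1 hx j).memLp_top_Icc.mono_exponent le_top) i).add
    ((MatrixMemLp.mono h.bdd_B ha hb).mulVec hv.eval i)

theorem IsRegular.isTrajectory_iff (h : P.IsRegular) {a b : ℝ} (ha : 0 ≤ a) (hab : a ≤ b)
    (hb : b ≤ P.T) {x : ℝ → Fin n → ℝ} {v : ℝ → Fin m → ℝ} :
    P.IsTrajectory a b x v ↔ MemLp v 2 (volume.restrict (Icc a b)) ∧
      IsVectorPrimitiveOn x (fun t => P.A t *ᵥ x t + P.B t *ᵥ v t) a b := by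
  constructor
  · rintro ⟨hx, hv, hxv⟩
    exact ⟨hv, (isVectorPrimitiveOn_iff (fun i => (h.memLp_vectorField ha hb hx hv i).integrableOn_Icc
      (by norm_num)) (left_mem_Icc.2 hab)).2 hxv⟩
  · rintro ⟨hv, hx⟩
    exact ⟨hx.continuousOn, hv,
      (isVectorPrimitiveOn_iff (fun i => (hx i).1) (left_mem_Icc.2 hab)).1 hx⟩

theorem IsRegular.exists_trajectory (h : P.IsRegular) {a b t₀ : ℝ} (ha : 0 ≤ a) (hb : b ≤ P.T)
    (ht₀ : t₀ ∈ Icc a b) (y : Fin n → ℝ) {v : ℝ → Fin m → ℝ}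
    (hv : MemLp v 2 (volume.restrict (Icc a b))) :
    ∃ x, x t₀ = y ∧ P.IsTrajectory a b x v := by
  obtain ⟨x, hx₀, hx⟩ := exists_linear_ode_solution (MatrixMemLp.mono h.bdd_A ha hb)
    (g := fun t => P.B t *ᵥ v t)
    (fun i => ((MatrixMemLp.mono h.bdd_B ha hb).mulVec hv.eval i).integrableOn_Icc (by norm_num))
    ht₀ y
  exact ⟨x, hx₀, (h.isTrajectory_iff ha (ht₀.1.trans ht₀.2) hb).2 ⟨hv, hx⟩⟩

theorem IsRegular.isTrajectory_add_smul (h : P.IsRegular) {a b : ℝ} (ha : 0 ≤ a) (hab : a ≤ b)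
    (hb : b ≤ P.T) {x y : ℝ → Fin n → ℝ} {v w : ℝ → Fin m → ℝ} (hx : P.IsTrajectory a b x v)
    (hy : P.IsTrajectory a b y w) (c : ℝ) :
    P.IsTrajectory a b (fun t => x t + c • y t) (fun t => v t + c • w t) := by
  rw [h.isTrajectory_iff ha hab hb] at *
  refine ⟨hx.1.add (hy.1.const_smul c), (hx.2.add (hy.2.const_smul c)).congr_deriv ?_⟩
  refine Eventually.of_forall fun t => ?_
  simp only [Matrix.mulVec_add, Matrix.mulVec_smul, smul_add]
  abel

theorem IsRegular.isTrajectory_mono (h : P.IsRegular) {a b c d : ℝ} (ha : 0 ≤ a)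
    (hac : a ≤ c) (hcd : c ≤ d) (hdb : d ≤ b) (hb : b ≤ P.T) {x : ℝ → Fin n → ℝ}
    {v : ℝ → Fin m → ℝ} (hx : P.IsTrajectory a b x v) : P.IsTrajectory c d x v := by
  rw [h.isTrajectory_iff ha (hac.trans (hcd.trans hdb)) hb] at hx
  rw [h.isTrajectory_iff (ha.trans hac) hcd (hdb.trans hb)]
  exact ⟨hx.1.mono_measure (Measure.restrict_mono (Icc_subset_Icc hac hdb) le_rfl),
    hx.2.mono hac hdb⟩

/-- Concatenation of trajectories. -/
theorem IsRegular.isTrajectory_glue (h : P.IsRegular) {a b c : ℝ} (ha : 0 ≤ a) (hab : a ≤ b)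
    (hbc : b ≤ c) (hc : c ≤ P.T) {x y : ℝ → Fin n → ℝ} {v w : ℝ → Fin m → ℝ}
    (hx : P.IsTrajectory a b x v) (hy : P.IsTrajectory b c y w) (hxy : x b = y b) :
    P.IsTrajectory a c ((Iic b).piecewise x y) ((Iic b).piecewise v w) := by
  rw [h.isTrajectory_iff ha hab (hbc.trans hc)] at hx
  rw [h.isTrajectory_iff (ha.trans hab) hbc hc] at hy
  rw [h.isTrajectory_iff ha (hab.trans hbc) hc]
  constructor
  · refine MemLp.piecewise measurableSet_Iic ?_ ?_
    · rw [Measure.restrict_restrict measurableSet_Iic]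
      refine hx.1.mono_measure (Measure.restrict_mono ?_ le_rfl)
      exact fun t ht => ⟨ht.2.1, ht.1⟩
    · rw [Measure.restrict_restrict measurableSet_Iic.compl]
      refine hy.1.mono_measure (Measure.restrict_mono ?_ le_rfl)
      exact fun t ht => ⟨(not_le.1 (show ¬ t ≤ b from ht.1)).le, ht.2.2⟩
  · refine IsVectorPrimitiveOn.glue hab hbc (hx.2.congr ?_ ?_) (hy.2.congr ?_ ?_)
    · exact fun t ht => piecewise_eq_of_mem _ _ _ (mem_Iic.2 ht.2)
    · filter_upwards [ae_restrict_mem measurableSet_Icc] with t ht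
      rw [piecewise_eq_of_mem _ _ _ (mem_Iic.2 ht.2), piecewise_eq_of_mem _ _ _ (mem_Iic.2 ht.2)]
    · intro t ht
      rcases eq_or_lt_of_le ht.1 with rfl | hlt
      · rw [piecewise_eq_of_mem _ _ _ (mem_Iic.2 le_rfl), hxy]
      · exact piecewise_eq_of_notMem _ _ _ (by simpa using hlt)
    · have hne : ∀ᵐ t ∂(volume.restrict (Icc b c)), t ≠ b :=
        ae_restrict_of_ae (Measure.ae_ne volume b)
      filter_upwards [ae_restrict_mem measurableSet_Icc, hne] with t ht htb
      have hn : t ∉ Iic b := by simpa using lt_of_le_of_ne ht.1 (Ne.symm htb)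
      rw [piecewise_eq_of_notMem _ _ _ hn, piecewise_eq_of_notMem _ _ _ hn]

/-! ### The cost form -/

variable (P) in
/-- The bilinear form of the weight at time `t`. -/
noncomputable def form (t : ℝ) (x : Fin n → ℝ) (v : Fin m → ℝ) (y : Fin n → ℝ) (w : Fin m → ℝ) :
    ℝ :=
  Sum.elim x v ⬝ᵥ (P.weight t *ᵥ Sum.elim y w)

theorem dotProduct_fromBlocks_mulVec (A : Matrix (Fin n) (Fin n) ℝ) (B : Matrix (Fin n) (Fin m) ℝ)
    (C : Matrix (Fin m) (Fin n) ℝ) (D : Matrix (Fin m) (Fin m) ℝ) (x y : Fin n → ℝ)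
    (v w : Fin m → ℝ) : Sum.elim x v ⬝ᵥ (Matrix.fromBlocks A B C D *ᵥ Sum.elim y w) =
      x ⬝ᵥ (A *ᵥ y + B *ᵥ w) + v ⬝ᵥ (C *ᵥ y + D *ᵥ w) := by
  simp [Matrix.fromBlocks_mulVec]

theorem form_eq (t : ℝ) (x : Fin n → ℝ) (v : Fin m → ℝ) (y : Fin n → ℝ) (w : Fin m → ℝ) :
    P.form t x v y w = x ⬝ᵥ (P.Q t *ᵥ y + P.N t *ᵥ w) + v ⬝ᵥ ((P.N t)ᵀ *ᵥ y + P.R t *ᵥ w) := by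
  rw [form, weight, dotProduct_fromBlocks_mulVec]

theorem IsRegular.integrableOn_form (h : P.IsRegular) {a b : ℝ} (ha : 0 ≤ a) (hb : b ≤ P.T)
    {x y : ℝ → Fin n → ℝ} {v w : ℝ → Fin m → ℝ} (hx : P.IsTrajectory a b x v)
    (hy : P.IsTrajectory a b y w) :
    IntegrableOn (fun t => P.form t (x t) (v t) (y t) (w t)) (Icc a b) := by
  have hmem : ∀ {x : ℝ → Fin n → ℝ} {v : ℝ → Fin m → ℝ}, P.IsTrajectory a b x v →
      ∀ k, MemLp (fun t => Sum.elim (x t) (v t) k) 2 (volume.restrict (Icc a b)) := by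
    rintro x v hx (i | i)
    · exact (continuousOn_pi.1 hx.1 i).memLp_top_Icc.mono_exponent le_top
    · exact hx.2.1.eval i
  have hW : MatrixMemLp P.weight ⊤ (volume.restrict (Icc a b)) :=
    MatrixMemLp.mono (MatrixMemLp.fromBlocks h.bdd_Q h.bdd_N (MatrixMemLp.transpose h.bdd_N)
      h.bdd_R) ha hb
  have := integrable_finsetSum Finset.univ fun k _ =>
    (hmem hx k).integrable_mul (hW.mulVec (hmem hy) k)
  exact this

theorem IsRegular.ae_form_symm (h : P.IsRegular) : ∀ᵐ t ∂(volume.restrict (Icc 0 P.T)),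
    ∀ x v y w, P.form t x v y w = P.form t y w x v := by
  filter_upwards [h.ae_R, h.symm_Q] with t hR hQ x v y w
  have hW : (P.weight t)ᵀ = P.weight t := by
    rw [weight, Matrix.fromBlocks_transpose, hQ.eq, hR.1.eq, Matrix.transpose_transpose]
  rw [form, form, Matrix.dotProduct_mulVec, ← Matrix.mulVec_transpose, hW, dotProduct_comm]

theorem cost_eq (x : ℝ → Fin n → ℝ) (v : ℝ → Fin m → ℝ) :
    P.cost x v = ∫ t in (0 : ℝ)..P.T, P.form t (x t) (v t) (x t) (v t) := rfl

/-- The cost along a line of trajectories. -/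
theorem IsRegular.cost_add_smul (h : P.IsRegular) {x y : ℝ → Fin n → ℝ} {v w : ℝ → Fin m → ℝ}
    (hx : P.IsTrajectory 0 P.T x v) (hy : P.IsTrajectory 0 P.T y w) (c : ℝ) :
    P.cost (fun t => x t + c • y t) (fun t => v t + c • w t) = P.cost x v
      + 2 * c * (∫ t in (0 : ℝ)..P.T, P.form t (x t) (v t) (y t) (w t)) + c ^ 2 * P.cost y w := by
  have hT := h.horizon_pos.le
  have hi : ∀ {x y : ℝ → Fin n → ℝ} {v w : ℝ → Fin m → ℝ},
      P.IsTrajectory 0 P.T x v → P.IsTrajectory 0 P.T y w →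
      IntervalIntegrable (fun t => P.form t (x t) (v t) (y t) (w t)) volume 0 P.T :=
    fun hx hy => (intervalIntegrable_iff_integrableOn_Icc_of_le hT).2
      (h.integrableOn_form le_rfl le_rfl hx hy)
  simp only [cost_eq]
  rw [← intervalIntegral.integral_const_mul, ← intervalIntegral.integral_const_mul,
    ← intervalIntegral.integral_add (hi hx hx) ((hi hx hy).const_mul _),
    ← intervalIntegral.integral_add ((hi hx hx).add ((hi hx hy).const_mul _))
      ((hi hy hy).const_mul _)]
  apply intervalIntegral.integral_congr_ae
  have hs := h.ae_form_symm
  rw [ae_restrict_iff' measurableSet_Icc] at hs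
  filter_upwards [hs] with t ht hmem
  rw [uIoc_of_le hT] at hmem
  have hsym := ht ⟨hmem.1.le, hmem.2⟩ (y t) (w t) (x t) (v t)
  simp only [form_eq, Matrix.mulVec_add, Matrix.mulVec_smul, dotProduct_add, add_dotProduct,
    smul_dotProduct, dotProduct_smul, smul_eq_mul] at hsym ⊢
  linear_combination c * hsym

/-! ### The DLMI, completion of the square and the optimal value. -/

variable (P) in
/-- The matrix of the differential linear matrix inequality. -/
noncomputable def dlmiMatrix (L D : ℝ → Matrix (Fin n) (Fin n) ℝ) (t : ℝ) :
    Matrix (Fin n ⊕ Fin m) (Fin n ⊕ Fin m) ℝ :=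
  P.weight t + Matrix.fromBlocks (D t + (P.A t)ᵀ * L t + L t * P.A t) (L t * P.B t)
    ((P.B t)ᵀ * L t) 0

/-- The cost on `[a, T]` is a boundary term plus the integral of the form of the DLMI. -/
theorem IsRegular.integral_form_eq (h : P.IsRegular) {a : ℝ} (ha : a ∈ Icc 0 P.T)
    {L D : ℝ → Matrix (Fin n) (Fin n) ℝ} (hL : P.HasDerivFinalZero a L D)
    {x : ℝ → Fin n → ℝ} {v : ℝ → Fin m → ℝ} (hx : P.IsTrajectory a P.T x v) :
    IntegrableOn (fun t => Sum.elim (x t) (v t) ⬝ᵥ (P.dlmiMatrix L D t *ᵥ Sum.elim (x t) (v t)))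
      (Icc a P.T) ∧
    ∫ t in a..P.T, P.form t (x t) (v t) (x t) (v t) = x a ⬝ᵥ (L a *ᵥ x a) +
      ∫ t in a..P.T, Sum.elim (x t) (v t) ⬝ᵥ (P.dlmiMatrix L D t *ᵥ Sum.elim (x t) (v t)) := by
  have hxp := ((h.isTrajectory_iff ha.1 ha.2 le_rfl).1 hx).2
  -- The boundary term is minus the increment of `x · L x` over `[a, T]`; its part at `T` is zero
  -- since `L(T) = 0`.
  have hprim := hxp.dotProduct ((hL.isMatrixPrimitiveOn ha.2).mulVec hxp)
  have hform := h.integrableOn_form ha.1 le_rfl hx hx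
  have haT : P.T ∈ Icc a P.T := right_mem_Icc.2 ha.2
  have haa : a ∈ Icc a P.T := left_mem_Icc.2 ha.2
  have hsum : ∀ t, Sum.elim (x t) (v t) ⬝ᵥ (P.dlmiMatrix L D t *ᵥ Sum.elim (x t) (v t)) =
      P.form t (x t) (v t) (x t) (v t) + ((P.A t *ᵥ x t + P.B t *ᵥ v t) ⬝ᵥ L t *ᵥ x t +
        x t ⬝ᵥ (D t *ᵥ x t + L t *ᵥ (P.A t *ᵥ x t + P.B t *ᵥ v t))) := by
    intro t
    have hA : x t ⬝ᵥ ((P.A t)ᵀ *ᵥ (L t *ᵥ x t)) = (P.A t *ᵥ x t) ⬝ᵥ (L t *ᵥ x t) := by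
      rw [Matrix.dotProduct_mulVec, Matrix.vecMul_transpose]
    have hB : v t ⬝ᵥ ((P.B t)ᵀ *ᵥ (L t *ᵥ x t)) = (P.B t *ᵥ v t) ⬝ᵥ (L t *ᵥ x t) := by
      rw [Matrix.dotProduct_mulVec, Matrix.vecMul_transpose]
    rw [dlmiMatrix, Matrix.add_mulVec, dotProduct_add, form]
    congr 1
    simp only [dotProduct_fromBlocks_mulVec, Matrix.add_mulVec,
      Matrix.mulVec_add, dotProduct_add, add_dotProduct, ← Matrix.mulVec_mulVec, hA, hB,
      Matrix.zero_mulVec, dotProduct_zero]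
    ring
  simp only [hsum]
  refine ⟨hform.add hprim.1, ?_⟩
  rw [intervalIntegral.integral_add (IntegrableOn.intervalIntegrable_of_mem hform haa haT)
    (IntegrableOn.intervalIntegrable_of_mem hprim.1 haa haT), ← hprim.sub_eq haa haT,
    hL.apply_horizon ha.2, Matrix.zero_mulVec, dotProduct_zero]
  ring

/-- A solution of the DLMI gives a lower bound for the cost. -/
theorem IsRegular.le_integral_form (h : P.IsRegular) {a : ℝ} (ha : a ∈ Icc 0 P.T)
    {L : ℝ → Matrix (Fin n) (Fin n) ℝ} (hL : P.IsDLMISolution L)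
    {x : ℝ → Fin n → ℝ} {v : ℝ → Fin m → ℝ} (hx : P.IsTrajectory a P.T x v) :
    x a ⬝ᵥ (L a *ᵥ x a) ≤ ∫ t in a..P.T, P.form t (x t) (v t) (x t) (v t) := by
  obtain ⟨D, hD, hpos⟩ := hL
  have hD' : P.HasDerivFinalZero a L D :=
    ⟨fun i j => (hD.1 i j).mono_set (by
      rw [uIcc_of_le ha.2, uIcc_of_le (ha.1.trans ha.2)]; exact Icc_subset_Icc_left ha.1),
      fun t ht => hD.2.1 t ⟨ha.1.trans ht.1, ht.2⟩, fun t ht => hD.2.2 t ⟨ha.1.trans ht.1, ht.2⟩⟩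
  rw [(h.integral_form_eq ha hD' hx).2, le_add_iff_nonneg_right]
  refine intervalIntegral.integral_nonneg_of_ae_restrict ha.2 ?_
  filter_upwards [ae_restrict_Icc_mono ha.1 le_rfl hpos] with t ht
  exact ht.dotProduct_mulVec_nonneg _

variable (P) in
/-- The deviation of the input `v` from the static state feedback. -/
noncomputable def feedbackError (L : ℝ → Matrix (Fin n) (Fin n) ℝ) (t : ℝ) (x : Fin n → ℝ)
    (v : Fin m → ℝ) : Fin m → ℝ :=
  v + ((P.R t)⁻¹ * ((P.N t)ᵀ + (P.B t)ᵀ * L t)) *ᵥ x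

theorem isFeedback_iff {L : ℝ → Matrix (Fin n) (Fin n) ℝ} {x : ℝ → Fin n → ℝ}
    {v : ℝ → Fin m → ℝ} : P.IsFeedback L x v ↔
      ∀ᵐ t ∂(volume.restrict (Icc 0 P.T)), P.feedbackError L t (x t) (v t) = 0 := by
  simp only [IsFeedback, feedbackError, eq_neg_iff_add_eq_zero]

/-- Completion of the square. -/
theorem dlmiMatrix_form {t : ℝ} (hR : (P.R t).IsSymm ∧ IsUnit (P.R t).det)
    {L D : ℝ → Matrix (Fin n) (Fin n) ℝ} (hL : (L t).IsSymm)
    (hric : P.Q t + D t + (P.A t)ᵀ * L t + L t * P.A t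
        - (P.N t + L t * P.B t) * (P.R t)⁻¹ * (P.N t + L t * P.B t)ᵀ = 0)
    (x : Fin n → ℝ) (v : Fin m → ℝ) :
    Sum.elim x v ⬝ᵥ (P.dlmiMatrix L D t *ᵥ Sum.elim x v) =
      P.feedbackError L t x v ⬝ᵥ (P.R t *ᵥ P.feedbackError L t x v) := by
  have hK : (P.N t + L t * P.B t)ᵀ = (P.N t)ᵀ + (P.B t)ᵀ * L t := by
    rw [Matrix.transpose_add, Matrix.transpose_mul, hL.eq]
  have hK' : P.N t + L t * P.B t = ((P.N t)ᵀ + (P.B t)ᵀ * L t)ᵀ := by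
    rw [← hK, Matrix.transpose_transpose]
  rw [sub_eq_zero, hK] at hric
  have hRR : P.R t * (P.R t)⁻¹ = 1 := Matrix.mul_nonsing_inv _ hR.2
  -- The Riccati equation turns the upper left block into `Kᵀ R⁻¹ K`, with `K = Nᵀ + Bᵀ L`. The
  -- quadratic form is then the `R`-square of `v + R⁻¹ K x`.
  have hblock : P.dlmiMatrix L D t = Matrix.fromBlocks
      ((P.N t + L t * P.B t) * (P.R t)⁻¹ * ((P.N t)ᵀ + (P.B t)ᵀ * L t))
      (P.N t + L t * P.B t) ((P.N t)ᵀ + (P.B t)ᵀ * L t) (P.R t) := by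
    rw [dlmiMatrix, weight, Matrix.fromBlocks_add, add_zero, ← hric]
    congr 1
    abel
  rw [hblock, dotProduct_fromBlocks_mulVec, feedbackError, hK']
  set K := (P.N t)ᵀ + (P.B t)ᵀ * L t
  have h1 : ∀ w : Fin m → ℝ, x ⬝ᵥ (Kᵀ *ᵥ w) = (K *ᵥ x) ⬝ᵥ w := fun w => by
    rw [Matrix.dotProduct_mulVec, Matrix.vecMul_transpose]
  have h2 : ∀ u w : Fin m → ℝ, u ⬝ᵥ (P.R t *ᵥ w) = (P.R t *ᵥ u) ⬝ᵥ w := fun u w => by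
    rw [Matrix.dotProduct_mulVec, ← Matrix.mulVec_transpose, hR.1.eq]
  have h3 : ∀ u : Fin m → ℝ, P.R t *ᵥ ((P.R t)⁻¹ *ᵥ u) = u := fun u => by
    rw [Matrix.mulVec_mulVec, hRR, Matrix.one_mulVec]
  simp only [← Matrix.mulVec_mulVec, Matrix.mulVec_add, dotProduct_add, add_dotProduct, h1, h3]
  rw [h2 ((P.R t)⁻¹ *ᵥ K *ᵥ x) v, h3, dotProduct_comm ((P.R t)⁻¹ *ᵥ K *ᵥ x) (K *ᵥ x)]
  ring

theorem IsDRESolution.isDLMISolution (h : P.IsRegular) {L : ℝ → Matrix (Fin n) (Fin n) ℝ}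
    (hL : P.IsDRESolution 0 L) : P.IsDLMISolution L := by
  obtain ⟨D, hD, hric⟩ := hL
  obtain ⟨ρ, hρ, hcoer⟩ := h.coercive
  refine ⟨D, hD, ?_⟩
  filter_upwards [hric, h.ae_R, h.symm_Q, hcoer, ae_restrict_mem measurableSet_Icc]
    with t h1 hR hQ hc ht
  have hLs := hD.2.2 t ht
  change (P.dlmiMatrix L D t).PosSemidef
  refine Matrix.PosSemidef.of_dotProduct_mulVec_nonneg ?_ fun z => ?_
  · have hRi : ((P.R t)⁻¹)ᵀ = (P.R t)⁻¹ := by rw [Matrix.transpose_nonsing_inv, hR.1]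
    have h11 : P.Q t + (D t + (P.A t)ᵀ * L t + L t * P.A t) =
        (P.N t + L t * P.B t) * (P.R t)⁻¹ * (P.N t + L t * P.B t)ᵀ := by
      rw [← sub_eq_zero, ← h1]; abel
    rw [dlmiMatrix, weight, Matrix.fromBlocks_add, h11, Matrix.IsHermitian,
      Matrix.conjTranspose_eq_transpose_of_trivial, Matrix.fromBlocks_transpose, add_zero, hR.1.eq]
    congr 1
    · simp only [Matrix.transpose_mul, Matrix.transpose_transpose, hRi, Matrix.mul_assoc]
    · simp [Matrix.transpose_mul, hLs.eq]
    · simp [Matrix.transpose_mul, hLs.eq]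
  · rw [star_trivial, ← Sum.elim_comp_inl_inr z, dlmiMatrix_form hR hLs h1]
    refine le_trans ?_ (hc.coercive _)
    exact mul_nonneg hρ.le (by simpa using dotProduct_star_self_nonneg (P.feedbackError L t _ _))

/-- The cost on `[a, T]` in terms of a Riccati solution. -/
theorem IsDRESolution.integral_form_eq (h : P.IsRegular) {a : ℝ} (ha : a ∈ Icc 0 P.T)
    {L : ℝ → Matrix (Fin n) (Fin n) ℝ} (hL : P.IsDRESolution a L)
    {x : ℝ → Fin n → ℝ} {v : ℝ → Fin m → ℝ} (hx : P.IsTrajectory a P.T x v) :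
    IntegrableOn (fun t => P.feedbackError L t (x t) (v t) ⬝ᵥ
      (P.R t *ᵥ P.feedbackError L t (x t) (v t))) (Icc a P.T) ∧
    ∫ t in a..P.T, P.form t (x t) (v t) (x t) (v t) = x a ⬝ᵥ (L a *ᵥ x a) +
      ∫ t in a..P.T, P.feedbackError L t (x t) (v t) ⬝ᵥ
        (P.R t *ᵥ P.feedbackError L t (x t) (v t)) := by
  obtain ⟨D, hD, hric⟩ := hL
  obtain ⟨hint, heq⟩ := h.integral_form_eq ha hD hx
  have hae : ∀ᵐ t ∂(volume.restrict (Icc a P.T)),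
      Sum.elim (x t) (v t) ⬝ᵥ (P.dlmiMatrix L D t *ᵥ Sum.elim (x t) (v t)) =
      P.feedbackError L t (x t) (v t) ⬝ᵥ (P.R t *ᵥ P.feedbackError L t (x t) (v t)) := by
    filter_upwards [hric, ae_restrict_Icc_mono ha.1 le_rfl h.ae_R,
      ae_restrict_mem measurableSet_Icc] with t h1 hR ht
    exact dlmiMatrix_form hR (hD.2.2 t ht) h1 _ _
  refine ⟨hint.congr hae, ?_⟩
  rw [heq]
  congr 1
  apply intervalIntegral.integral_congr_ae_restrict
  rw [uIoc_of_le ha.2]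
  exact ae_restrict_of_ae_restrict_of_subset Ioc_subset_Icc_self hae

/-- The closed loop of the static state feedback has a solution. -/
theorem IsDRESolution.exists_feedback (h : P.IsRegular) {a : ℝ} (ha : a ∈ Icc 0 P.T)
    {L : ℝ → Matrix (Fin n) (Fin n) ℝ} (hL : P.IsDRESolution a L) (y : Fin n → ℝ) :
    ∃ x v, P.IsTrajectory a P.T x v ∧ x a = y ∧ ∀ t, P.feedbackError L t (x t) (v t) = 0 := by
  obtain ⟨D, hD, -⟩ := hL
  set K : ℝ → Matrix (Fin m) (Fin n) ℝ := fun t => (P.R t)⁻¹ * ((P.N t)ᵀ + (P.B t)ᵀ * L t)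
  have hK : MatrixMemLp K ⊤ (volume.restrict (Icc a P.T)) :=
    (h.bdd_R_inv.mono ha.1 le_rfl).mul (((MatrixMemLp.transpose h.bdd_N).mono ha.1 le_rfl).add
      (((MatrixMemLp.transpose h.bdd_B).mono ha.1 le_rfl).mul
        (hD.isMatrixPrimitiveOn ha.2).memLp_top))
  obtain ⟨x, hx₀, hx⟩ := exists_linear_ode_solution
    (M := fun t => P.A t - P.B t * K t) (g := 0)
    ((MatrixMemLp.mono h.bdd_A ha.1 le_rfl).sub ((MatrixMemLp.mono h.bdd_B ha.1 le_rfl).mul hK))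
    (fun i => integrableOn_zero) (left_mem_Icc.2 ha.2) y
  refine ⟨x, fun t => -(K t *ᵥ x t), (h.isTrajectory_iff ha.1 ha.2 le_rfl).2 ⟨?_, ?_⟩, hx₀, ?_⟩
  · refine MemLp.of_eval fun i => ?_
    exact ((hK.mulVec (fun j => (hx j).continuousOn.memLp_top_Icc) i).neg).mono_exponent le_top
  · refine hx.congr_deriv (Eventually.of_forall fun t => ?_)
    simp only [Matrix.add_mulVec, Matrix.neg_mulVec, Matrix.mulVec_neg, Matrix.mulVec_mulVec,
      sub_eq_add_neg,
      Pi.zero_apply, add_zero]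
  · intro t
    simp [feedbackError, K]

/-- The closed loop started at time `t` in `y` costs exactly `y · L(t) y` over `[t, T]`, and every
DLMI solution bounds that cost from below. -/
theorem IsDRESolution.isMaximalDLMISolution (h : P.IsRegular)
    {L : ℝ → Matrix (Fin n) (Fin n) ℝ} (hL : P.IsDRESolution 0 L) :
    P.IsMaximalDLMISolution L := by
  refine ⟨hL.isDLMISolution h, fun L' hL' t ht => ?_⟩
  have hLt : P.IsDRESolution t L := by
    obtain ⟨D, hD, hric⟩ := hL
    refine ⟨D, ⟨fun i j => (hD.1 i j).mono_set (by
      rw [uIcc_of_le ht.2, uIcc_of_le (ht.1.trans ht.2)]; exact Icc_subset_Icc_left ht.1),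
      fun s hs => hD.2.1 s ⟨ht.1.trans hs.1, hs.2⟩, fun s hs => hD.2.2 s ⟨ht.1.trans hs.1, hs.2⟩⟩,
      ae_restrict_Icc_mono ht.1 le_rfl hric⟩
  have hs : (L t - L' t).IsSymm := by
    obtain ⟨D, hD, -⟩ := hL
    obtain ⟨D', hD', -⟩ := hL'
    exact (hD.2.2 t ht).sub (hD'.2.2 t ht)
  refine Matrix.PosSemidef.of_dotProduct_mulVec_nonneg ?_ fun y => ?_
  · rw [Matrix.IsHermitian, Matrix.conjTranspose_eq_transpose_of_trivial, hs.eq]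
  · obtain ⟨x, v, hx, hx₀, herr⟩ := hLt.exists_feedback h ht y
    have h1 := (hLt.integral_form_eq h ht hx).2
    have h2 := h.le_integral_form ht hL' hx
    simp only [herr, Matrix.mulVec_zero, dotProduct_zero, intervalIntegral.integral_zero, add_zero,
      hx₀] at h1 h2
    rw [star_trivial, Matrix.sub_mulVec, dotProduct_sub]
    linarith

/-- The excess cost is the integral of the `R`-square of the feedback error; by coercivity it is
nonnegative and vanishes only if the error is zero almost everywhere. -/
theorem IsDRESolution.cost_eq_iff (h : P.IsRegular) {L : ℝ → Matrix (Fin n) (Fin n) ℝ}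
    (hL : P.IsDRESolution 0 L) {x₀ : Fin n → ℝ} {x : ℝ → Fin n → ℝ} {v : ℝ → Fin m → ℝ}
    (hx : P.IsAdmissible x₀ x v) :
    x₀ ⬝ᵥ (L 0 *ᵥ x₀) ≤ P.cost x v ∧
      (P.cost x v = x₀ ⬝ᵥ (L 0 *ᵥ x₀) ↔ P.IsFeedback L x v) := by
  have h0T : (0 : ℝ) ∈ Icc 0 P.T := left_mem_Icc.2 h.horizon_pos.le
  obtain ⟨hint, heq⟩ := hL.integral_form_eq h h0T hx.1
  obtain ⟨ρ, hρ, hcoer⟩ := h.coercive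
  have hnn : ∀ u : Fin m → ℝ, 0 ≤ u ⬝ᵥ u := fun u => by
    simpa using dotProduct_star_self_nonneg u
  have hpos : ∀ᵐ t ∂(volume.restrict (Icc 0 P.T)), 0 ≤ P.feedbackError L t (x t) (v t) ⬝ᵥ
      (P.R t *ᵥ P.feedbackError L t (x t) (v t)) := by
    filter_upwards [hcoer] with t hc
    exact (mul_nonneg hρ.le (hnn _)).trans (hc.coercive _)
  rw [hx.2] at heq
  rw [cost_eq, heq]
  refine ⟨le_add_of_nonneg_right
    (intervalIntegral.integral_nonneg_of_ae_restrict h.horizon_pos.le hpos), ?_⟩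
  rw [add_eq_left, intervalIntegral.integral_of_le h.horizon_pos.le,
    ← integral_Icc_eq_integral_Ioc, integral_eq_zero_iff_of_nonneg_ae hpos hint, isFeedback_iff]
  constructor
  · intro h0
    filter_upwards [h0, hcoer] with t ht hc
    have h1 := hc.coercive (P.feedbackError L t (x t) (v t))
    simp only [Pi.zero_apply] at ht
    rw [ht] at h1
    have h2 : P.feedbackError L t (x t) (v t) ⬝ᵥ P.feedbackError L t (x t) (v t) = 0 :=
      le_antisymm (by nlinarith) (hnn _)
    exact dotProduct_self_eq_zero.1 h2
  · intro h0
    filter_upwards [h0] with t ht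
    simp [ht]

theorem IsDRESolution.infCost_eq (h : P.IsRegular) {L : ℝ → Matrix (Fin n) (Fin n) ℝ}
    (hL : P.IsDRESolution 0 L) (x₀ : Fin n → ℝ) :
    P.infCost x₀ = ((x₀ ⬝ᵥ (L 0 *ᵥ x₀) : ℝ) : EReal) := by
  apply le_antisymm
  · obtain ⟨x, v, hx, hx₀, herr⟩ := hL.exists_feedback h (left_mem_Icc.2 h.horizon_pos.le) x₀
    refine sInf_le ⟨x, v, ⟨hx, hx₀⟩, ?_⟩
    rw [((hL.cost_eq_iff h ⟨hx, hx₀⟩).2).2 (isFeedback_iff.2 (Eventually.of_forall herr))]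
  · refine le_sInf ?_
    rintro c ⟨x, v, hx, rfl⟩
    exact EReal.coe_le_coe_iff.2 (hL.cost_eq_iff h hx).1

end LQProblem

namespace LQProblem

variable {n m : ℕ} {P : LQProblem n m}

/-! ### Degenerate trajectories -/

variable (P) in
/-- The optimal input of the Hamiltonian system in terms of state and costate. -/
noncomputable def hamInput (x l : ℝ → Fin n → ℝ) (t : ℝ) : Fin m → ℝ :=
  -((P.R t)⁻¹ *ᵥ ((P.N t)ᵀ *ᵥ x t + (P.B t)ᵀ *ᵥ l t))

/-- The state of the Hamiltonian system is a trajectory, and the costate represents the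
cost form. -/
theorem IsRegular.hamiltonian_trajectory (h : P.IsRegular) {a b : ℝ} (ha : 0 ≤ a) (hab : a ≤ b)
    (hb : b ≤ P.T) {x l : ℝ → Fin n → ℝ}
    (hx : IsVectorPrimitiveOn x (fun t => P.hamA t *ᵥ x t - P.hamG t *ᵥ l t) a b)
    (hl : IsVectorPrimitiveOn l (fun t => P.hamQ t *ᵥ x t - (P.hamA t)ᵀ *ᵥ l t) a b) :
    P.IsTrajectory a b x (P.hamInput x l) ∧
      ∀ z w, P.IsTrajectory a b z w →
        ∫ t in a..b, P.form t (z t) (w t) (x t) (P.hamInput x l t) =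
          l a ⬝ᵥ z a - l b ⬝ᵥ z b := by
  constructor
  · refine (h.isTrajectory_iff ha hab hb).2 ⟨MemLp.of_eval fun i => ?_, hx.congr_deriv ?_⟩
    · refine MemLp.mono_exponent (q := ⊤) (MemLp.neg ?_) le_top
      refine (h.bdd_R_inv.mono ha hb).mulVec (fun j => ?_) i
      exact ((MatrixMemLp.transpose h.bdd_N).mono ha hb |>.mulVec
          (fun k => (hx k).continuousOn.memLp_top_Icc) j).add
        ((MatrixMemLp.transpose h.bdd_B).mono ha hb |>.mulVec
          (fun k => (hl k).continuousOn.memLp_top_Icc) j)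
    · refine Eventually.of_forall fun t => ?_
      simp only [hamInput, hamA, hamG, Matrix.mulVec_neg, Matrix.mulVec_add, Matrix.sub_mulVec,
        Matrix.mulVec_mulVec, Matrix.mul_assoc]
      abel
  · intro z w hz
    have hzp := ((h.isTrajectory_iff ha hab hb).1 hz).2
    have hprim := hl.dotProduct hzp
    have := hprim.sub_eq (left_mem_Icc.2 hab) (right_mem_Icc.2 hab)
    rw [← neg_sub (l b ⬝ᵥ z b), this, ← intervalIntegral.integral_neg]
    apply intervalIntegral.integral_congr_ae_restrict
    rw [uIoc_of_le hab]
    filter_upwards [ae_restrict_of_ae_restrict_of_subset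
      (Ioc_subset_Icc_self.trans (Icc_subset_Icc ha hb)) h.ae_R] with t hR
    have hRi : ((P.R t)⁻¹)ᵀ = (P.R t)⁻¹ := by rw [Matrix.transpose_nonsing_inv, hR.1]
    -- The costate equation and, in `hRv`, the stationarity condition for the input, in terms of the
    -- original data. Together they show that the cost pairing is minus the derivative of `l · z`.
    have hl' : P.hamQ t *ᵥ x t - (P.hamA t)ᵀ *ᵥ l t =
        -(P.Q t *ᵥ x t + P.N t *ᵥ P.hamInput x l t) - (P.A t)ᵀ *ᵥ l t := by
      simp only [hamInput, hamA, hamQ, Matrix.transpose_sub, Matrix.transpose_mul, hRi,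
        Matrix.transpose_transpose, Matrix.mulVec_neg, Matrix.mulVec_add, Matrix.sub_mulVec,
        Matrix.mulVec_mulVec, Matrix.mul_assoc]
      abel
    have hRv : (P.N t)ᵀ *ᵥ x t + P.R t *ᵥ P.hamInput x l t = -((P.B t)ᵀ *ᵥ l t) := by
      rw [hamInput, Matrix.mulVec_neg, Matrix.mulVec_mulVec, Matrix.mul_nonsing_inv _ hR.2,
        Matrix.one_mulVec]
      abel
    have hA : ((P.A t)ᵀ *ᵥ l t) ⬝ᵥ z t = l t ⬝ᵥ (P.A t *ᵥ z t) := by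
      rw [Matrix.dotProduct_mulVec, Matrix.mulVec_transpose]
    have hB : ((P.B t)ᵀ *ᵥ l t) ⬝ᵥ w t = l t ⬝ᵥ (P.B t *ᵥ w t) := by
      rw [Matrix.dotProduct_mulVec, Matrix.mulVec_transpose]
    rw [form_eq, hl', hRv, dotProduct_neg, dotProduct_comm (w t), hB, sub_dotProduct, hA,
      neg_dotProduct, dotProduct_add (l t), dotProduct_comm (z t)]
    ring

/-- A trajectory from the origin, with a nonzero input, along which the cost form depends
only on the state at time `τ` in the direction `η`. -/
structure IsDegenerate (P : LQProblem n m) (τ : ℝ) (η : Fin n → ℝ) (x : ℝ → Fin n → ℝ)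
    (v : ℝ → Fin m → ℝ) : Prop where
  admissible : P.IsAdmissible 0 x v
  input_ne_zero : ¬ ∀ᵐ t ∂(volume.restrict (Icc 0 P.T)), v t = 0
  state_eq_zero : x τ = 0
  form_eq : ∀ z w, P.IsTrajectory 0 P.T z w →
    ∫ t in (0 : ℝ)..P.T, P.form t (z t) (w t) (x t) (v t) = η ⬝ᵥ z τ

theorem IsDegenerate.cost_eq_zero {τ : ℝ} {η : Fin n → ℝ} {x : ℝ → Fin n → ℝ}
    {v : ℝ → Fin m → ℝ} (hd : P.IsDegenerate τ η x v) : P.cost x v = 0 := by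
  rw [cost_eq, hd.form_eq _ _ hd.admissible.1, hd.state_eq_zero, dotProduct_zero]

/-- The trajectory rests at the origin until `τ` and then follows `X ξ`, which starts from `X(τ) ξ =
0`. The costate represents the pairing on `[τ, T]`, and `Y(T) = 0` leaves only the term at `τ`. -/
theorem IsTerminalSolution.exists_isDegenerate (h : P.IsRegular)
    {X Y : ℝ → Matrix (Fin n) (Fin n) ℝ} (hXY : P.IsTerminalSolution X Y) {τ : ℝ}
    (hτ : τ ∈ Icc 0 P.T) {ξ : Fin n → ℝ} (hξ : ξ ≠ 0) (hX : X τ *ᵥ ξ = 0) :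
    ∃ x v, P.IsDegenerate τ (Y τ *ᵥ ξ) x v := by
  have hT := h.horizon_pos.le
  have hτT : τ < P.T := by
    refine lt_of_le_of_ne hτ.2 fun heq => hξ ?_
    rwa [heq, hXY.left, Matrix.one_mulVec] at hX
  obtain ⟨hx, hl⟩ := (hXY.sol.mono hτ.1 le_rfl).mulVec ξ
  obtain ⟨htraj, hform⟩ := h.hamiltonian_trajectory hτ.1 hτ.2 le_rfl hx hl
  set x : ℝ → Fin n → ℝ := fun t => X t *ᵥ ξ
  set v := P.hamInput x fun t => Y t *ᵥ ξ
  have hzero : P.IsTrajectory 0 τ 0 0 := ⟨continuousOn_const, MemLp.zero, by simp⟩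
  have hglue := h.isTrajectory_glue le_rfl hτ.1 hτ.2 le_rfl hzero htraj hX.symm
  have h0 : (Iic τ).piecewise 0 x 0 = 0 := piecewise_eq_of_mem _ _ _ hτ.1
  have hend : (Iic τ).piecewise 0 x P.T = ξ := by
    rw [piecewise_eq_of_notMem _ _ _ (by simpa using hτT)]
    simp [x, hXY.left]
  refine ⟨_, _, ⟨hglue, h0⟩, fun hv => hξ ?_, ?_, fun z w hz => ?_⟩
  -- With zero input the state would stay at the origin, but it ends at `ξ`.
  · have hp := ((h.isTrajectory_iff le_rfl hT le_rfl).1 hglue).2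
    rw [← hend]
    refine linear_ode_eq_zero h.bdd_A (left_mem_Icc.2 hT) (hp.congr_deriv ?_) h0 P.T
      (right_mem_Icc.2 hT)
    filter_upwards [hv] with t ht
    rw [ht, Matrix.mulVec_zero, add_zero]
  · exact piecewise_eq_of_mem _ _ _ (mem_Iic.2 le_rfl)
  · have hz' := h.isTrajectory_mono le_rfl hτ.1 hτ.2 le_rfl le_rfl hz
    have hint := h.integrableOn_form le_rfl le_rfl hz hglue
    have hτ' : τ ∈ Icc 0 P.T := hτ
    rw [← intervalIntegral.integral_add_adjacent_intervals
      (IntegrableOn.intervalIntegrable_of_mem hint (left_mem_Icc.2 hT) hτ')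
      (IntegrableOn.intervalIntegrable_of_mem hint hτ' (right_mem_Icc.2 hT))]
    have h1 : ∫ t in (0 : ℝ)..τ, P.form t (z t) (w t) ((Iic τ).piecewise 0 x t)
        ((Iic τ).piecewise 0 v t) = 0 := by
      refine (intervalIntegral.integral_congr (g := fun _ => 0) fun t ht => ?_).trans
        intervalIntegral.integral_zero
      rw [uIcc_of_le hτ.1] at ht
      simp only [piecewise_eq_of_mem _ _ _ (mem_Iic.2 ht.2)]
      simp [LQProblem.form_eq]
    have h2 : ∫ t in τ..P.T, P.form t (z t) (w t) ((Iic τ).piecewise 0 x t)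
        ((Iic τ).piecewise 0 v t) = ∫ t in τ..P.T, P.form t (z t) (w t) (x t) (v t) := by
      apply intervalIntegral.integral_congr_ae
      refine Eventually.of_forall fun t ht => ?_
      rw [uIoc_of_le hτ.2] at ht
      have hn : t ∉ Iic τ := by simpa using ht.1
      rw [piecewise_eq_of_notMem _ _ _ hn, piecewise_eq_of_notMem _ _ _ hn]
    rw [h1, h2, zero_add, hform z w hz', hXY.right, Matrix.zero_mulVec, zero_dotProduct, sub_zero]

/-- The cost is unbounded below along the degenerate direction. -/
theorem IsDegenerate.infCost_eq_bot (h : P.IsRegular) {τ : ℝ} {η : Fin n → ℝ}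
    {x : ℝ → Fin n → ℝ} {v : ℝ → Fin m → ℝ} (hd : P.IsDegenerate τ η x v) {x₀ : Fin n → ℝ}
    {z : ℝ → Fin n → ℝ} {w : ℝ → Fin m → ℝ} (hz : P.IsAdmissible x₀ z w) (hη : η ⬝ᵥ z τ ≠ 0) :
    P.infCost x₀ = ⊥ := by
  refine sInf_eq_bot.2 fun b hb => ?_
  obtain ⟨r, -, hr⟩ := EReal.lt_iff_exists_real_btwn.1 hb
  -- The degenerate trajectory has zero cost, so the cost is affine in `c`; this `c` makes it equal
  -- to `r`.
  set c := (r - P.cost z w) / (2 * (η ⬝ᵥ z τ)) with hc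
  have hcost := h.cost_add_smul hz.1 hd.admissible.1 c
  rw [hd.form_eq _ _ hz.1, hd.cost_eq_zero] at hcost
  have hcr : P.cost z w + 2 * c * (η ⬝ᵥ z τ) + c ^ 2 * 0 = r := by
    rw [hc]; field_simp; ring
  refine ⟨r, ⟨_, _, ⟨h.isTrajectory_add_smul le_rfl h.horizon_pos.le le_rfl hz.1
    hd.admissible.1 c, ?_⟩, by rw [hcost, hcr]⟩, hr⟩
  simp [hz.2, hd.admissible.2]

theorem IsRegular.exists_admissible (h : P.IsRegular) (x₀ : Fin n → ℝ) :
    ∃ x, P.IsAdmissible x₀ x 0 := by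
  obtain ⟨x, hx₀, hx⟩ := h.exists_trajectory le_rfl le_rfl (left_mem_Icc.2 h.horizon_pos.le) x₀
    (v := 0) MemLp.zero
  exact ⟨x, hx, hx₀⟩

/-- If the origin has a trajectory of negative cost, then the infimum is `-∞` everywhere. -/
theorem IsRegular.infCost_eq_bot_of_cost_neg (h : P.IsRegular) {x : ℝ → Fin n → ℝ}
    {v : ℝ → Fin m → ℝ} (hx : P.IsAdmissible 0 x v) (hneg : P.cost x v < 0) (x₀ : Fin n → ℝ) :
    P.infCost x₀ = ⊥ := by
  refine sInf_eq_bot.2 fun b hb => ?_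
  obtain ⟨r, -, hr⟩ := EReal.lt_iff_exists_real_btwn.1 hb
  obtain ⟨z, hz⟩ := h.exists_admissible x₀
  set k := ∫ t in (0 : ℝ)..P.T, P.form t (z t) ((0 : ℝ → Fin m → ℝ) t) (x t) (v t)
  -- Along `z + c x` the cost is a quadratic polynomial in `c` with negative leading coefficient;
  -- this is its nonconstant part, factored.
  have hlim : Tendsto (fun c : ℝ => c * (c * P.cost x v + 2 * k)) atTop atBot :=
    tendsto_id.atTop_mul_atBot₀
      (tendsto_atBot_add_const_right _ _ (tendsto_id.atTop_mul_const_of_neg hneg))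
  obtain ⟨c, hc⟩ := (hlim.eventually (eventually_lt_atBot (r - P.cost z 0))).exists
  refine ⟨_, ⟨_, _, ⟨h.isTrajectory_add_smul le_rfl h.horizon_pos.le le_rfl hz.1 hx.1 c, ?_⟩,
    rfl⟩, lt_trans (EReal.coe_lt_coe_iff.2 ?_) hr⟩
  · simp [hz.2, hx.2]
  · rw [h.cost_add_smul hz.1 hx.1 c]
    linarith

/-! ### The adjoint equation -/

theorem IsRegular.exists_adjoint (h : P.IsRegular) {τ : ℝ} (hτ : τ ∈ Icc 0 P.T)
    (η : Fin n → ℝ) :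
    ∃ p, p τ = η ∧ IsVectorPrimitiveOn p (fun t => -((P.A t)ᵀ *ᵥ p t)) 0 P.T := by
  obtain ⟨p, hp, hp'⟩ := exists_linear_ode_solution (M := fun t => -(P.A t)ᵀ) (g := 0)
    (MatrixMemLp.transpose h.bdd_A).neg (fun i => integrableOn_zero) hτ η
  exact ⟨p, hp, hp'.congr_deriv (Eventually.of_forall fun t => by simp [Matrix.neg_mulVec])⟩

/-- In the derivative of `p · z` the terms with `A` cancel. Only the input changes the pairing. -/
theorem IsRegular.adjoint_sub_eq (h : P.IsRegular) {a b : ℝ} (ha : 0 ≤ a) (hab : a ≤ b)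
    (hb : b ≤ P.T) {p : ℝ → Fin n → ℝ}
    (hp : IsVectorPrimitiveOn p (fun t => -((P.A t)ᵀ *ᵥ p t)) a b) {z : ℝ → Fin n → ℝ}
    {w : ℝ → Fin m → ℝ} (hz : P.IsTrajectory a b z w) :
    IntegrableOn (fun t => ((P.B t)ᵀ *ᵥ p t) ⬝ᵥ w t) (Icc a b) ∧
    p b ⬝ᵥ z b - p a ⬝ᵥ z a = ∫ t in a..b, ((P.B t)ᵀ *ᵥ p t) ⬝ᵥ w t := by
  have hprim := (hp.dotProduct ((h.isTrajectory_iff ha hab hb).1 hz).2).congr_deriv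
    (g' := fun t => ((P.B t)ᵀ *ᵥ p t) ⬝ᵥ w t) (Eventually.of_forall fun t => ?_)
  · exact ⟨hprim.1, hprim.sub_eq (left_mem_Icc.2 hab) (right_mem_Icc.2 hab)⟩
  · have hA : ((P.A t)ᵀ *ᵥ p t) ⬝ᵥ z t = p t ⬝ᵥ (P.A t *ᵥ z t) := by
      rw [Matrix.dotProduct_mulVec, Matrix.mulVec_transpose]
    have hB : ((P.B t)ᵀ *ᵥ p t) ⬝ᵥ w t = p t ⬝ᵥ (P.B t *ᵥ w t) := by
      rw [Matrix.dotProduct_mulVec, Matrix.mulVec_transpose]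
    rw [hB, neg_dotProduct, hA, dotProduct_add]
    ring

/-- If the trajectory with input `Bᵀ p` does not change the pairing with the adjoint solution `p`,
then `Bᵀ p = 0`. -/
theorem IsRegular.adjoint_input_eq_zero (h : P.IsRegular) {a b : ℝ} (ha : 0 ≤ a) (hab : a ≤ b)
    (hb : b ≤ P.T) {p : ℝ → Fin n → ℝ}
    (hp : IsVectorPrimitiveOn p (fun t => -((P.A t)ᵀ *ᵥ p t)) a b) {z : ℝ → Fin n → ℝ}
    (hz : P.IsTrajectory a b z (fun t => (P.B t)ᵀ *ᵥ p t))
    (heq : p b ⬝ᵥ z b = p a ⬝ᵥ z a) :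
    ∀ᵐ t ∂(volume.restrict (Icc a b)), (P.B t)ᵀ *ᵥ p t = 0 := by
  obtain ⟨hint, hsub⟩ := h.adjoint_sub_eq ha hab hb hp hz
  rw [heq, sub_self, intervalIntegral.integral_of_le hab, ← integral_Icc_eq_integral_Ioc,
    eq_comm, integral_eq_zero_iff_of_nonneg (fun t => ?_) hint] at hsub
  · filter_upwards [hsub] with t ht
    exact dotProduct_self_eq_zero.1 ht
  · simpa using dotProduct_star_self_nonneg ((P.B t)ᵀ *ᵥ p t)

theorem IsRegular.memLp_adjoint_input (h : P.IsRegular) {a b : ℝ} (ha : 0 ≤ a) (hb : b ≤ P.T)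
    {p : ℝ → Fin n → ℝ} (hp : ContinuousOn p (Icc a b)) :
    MemLp (fun t => (P.B t)ᵀ *ᵥ p t) 2 (volume.restrict (Icc a b)) :=
  MemLp.of_eval fun i => (((MatrixMemLp.transpose h.bdd_B).mono ha hb).mulVec
    (fun j => (continuousOn_pi.1 hp j).memLp_top_Icc) i).mono_exponent le_top

/-- The adjoint solution starting at the costate of a singular direction is observable. -/
theorem IsTerminalSolution.not_adjoint_input_eq_zero (h : P.IsRegular)
    {X Y : ℝ → Matrix (Fin n) (Fin n) ℝ} (hXY : P.IsTerminalSolution X Y) {τ : ℝ}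
    (hτ : τ ∈ Icc 0 P.T) {ξ : Fin n → ℝ} (hξ : ξ ≠ 0) (hX : X τ *ᵥ ξ = 0)
    {p : ℝ → Fin n → ℝ} (hp : IsVectorPrimitiveOn p (fun t => -((P.A t)ᵀ *ᵥ p t)) τ P.T)
    (hpτ : p τ = Y τ *ᵥ ξ) :
    ¬ ∀ᵐ t ∂(volume.restrict (Icc τ P.T)), (P.B t)ᵀ *ᵥ p t = 0 := by
  intro hB
  obtain ⟨hx, hl⟩ := (hXY.sol.mono hτ.1 le_rfl).mulVec ξ
  -- If `Bᵀ p = 0`, then `(0, p)` solves the Hamiltonian system. Subtracting it from `(X ξ, Y ξ)`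
  -- gives a solution that vanishes at `τ`, hence also at `T`, where the state is `ξ`.
  have key := h.hamiltonian_eq_zero hτ.1 le_rfl (left_mem_Icc.2 hτ.2)
    (x := fun t => X t *ᵥ ξ) (l := fun t => Y t *ᵥ ξ + -p t) (hx.congr_deriv ?_)
    ((hl.add hp.neg).congr_deriv ?_) hX (by simp [hpτ]) P.T (right_mem_Icc.2 hτ.2)
  · exact hξ (by simpa [hXY.left] using key.1)
  · filter_upwards [hB] with t ht
    rw [Matrix.mulVec_add, Matrix.mulVec_neg, hamG, ← Matrix.mulVec_mulVec (p t), ht,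
      Matrix.mulVec_zero, neg_zero, add_zero]
  · filter_upwards [hB, ae_restrict_Icc_mono hτ.1 le_rfl h.ae_R] with t ht hR
    have hA : (P.hamA t)ᵀ *ᵥ p t = (P.A t)ᵀ *ᵥ p t := by
      rw [hamA, Matrix.transpose_sub, Matrix.sub_mulVec, Matrix.transpose_mul,
        Matrix.transpose_mul, ← Matrix.mulVec_mulVec, ← Matrix.mulVec_mulVec, ht,
        Matrix.mulVec_zero, Matrix.mulVec_zero, sub_zero]
    rw [Matrix.mulVec_add, Matrix.mulVec_neg, hA]
    abel

/-- The infimum is `-∞` off a hyperplane. -/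
theorem IsDegenerate.exists_submodule (h : P.IsRegular) {τ : ℝ} (hτ : τ ∈ Icc 0 P.T)
    {η : Fin n → ℝ} (hη : η ≠ 0) {x : ℝ → Fin n → ℝ} {v : ℝ → Fin m → ℝ}
    (hd : P.IsDegenerate τ η x v) :
    ∃ S : Submodule ℝ (Fin n → ℝ), S ≠ ⊤ ∧ ∀ x₀, x₀ ∉ S → P.infCost x₀ = ⊥ := by
  obtain ⟨p, hpτ, hp⟩ := h.exists_adjoint hτ η
  -- Without input `p · z` is constant, so `η · z(τ) = p(0) · x₀`. The hyperplane orthogonal to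
  -- `p(0)` is thus where the zero-input trajectory gives no descent; it is proper because `η ≠ 0`
  -- forces `p(0) ≠ 0`.
  let S : Submodule ℝ (Fin n → ℝ) :=
    { carrier := {y | p 0 ⬝ᵥ y = 0}
      add_mem' := fun {y z} hy hz => by
        simp only [mem_ofPred_eq] at *
        rw [dotProduct_add, hy, hz, add_zero]
      zero_mem' := dotProduct_zero _
      smul_mem' := fun c y hy => by
        simp only [mem_ofPred_eq] at *
        rw [dotProduct_smul, hy, smul_zero] }
  refine ⟨S, fun hS => hη ?_, fun x₀ hx₀ => ?_⟩
  · have h0 : p 0 ∈ S := hS ▸ Submodule.mem_top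
    have hp0 : p 0 = 0 := dotProduct_self_eq_zero.1 h0
    rw [← hpτ]
    exact linear_ode_eq_zero (M := fun t => -(P.A t)ᵀ) (MatrixMemLp.transpose h.bdd_A).neg
      (left_mem_Icc.2 h.horizon_pos.le) (hp.congr_deriv
        (Eventually.of_forall fun t => by simp [Matrix.neg_mulVec])) hp0 τ hτ
  · obtain ⟨z, hz⟩ := h.exists_admissible x₀
    refine hd.infCost_eq_bot h hz fun h0 => hx₀ ?_
    have := (h.adjoint_sub_eq le_rfl hτ.1 hτ.2 (hp.mono le_rfl hτ.2)
      (h.isTrajectory_mono le_rfl le_rfl hτ.1 hτ.2 le_rfl hz.1)).2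
    simp only [Pi.zero_apply, dotProduct_zero, intervalIntegral.integral_zero, hpτ, h0, hz.2,
      zero_sub, neg_eq_zero] at this
    exact this

/-- Either some trajectory from the origin has negative cost, and scaling it drives every infimum to
`-∞`, or the infimum at the origin is zero and the degenerate trajectory attains it. -/
theorem IsDegenerate.bot_or_degenerate (h : P.IsRegular) {τ : ℝ} {η : Fin n → ℝ}
    {x : ℝ → Fin n → ℝ} {v : ℝ → Fin m → ℝ} (hd : P.IsDegenerate τ η x v) :
    (∀ x₀, P.infCost x₀ = ⊥) ∨
      (P.infCost 0 = 0 ∧ ∃ x v, P.IsAdmissible 0 x v ∧ P.cost x v = 0 ∧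
        ¬ ∀ᵐ t ∂(volume.restrict (Icc 0 P.T)), v t = 0) := by
  by_cases hneg : ∃ z w, P.IsAdmissible 0 z w ∧ P.cost z w < 0
  · obtain ⟨z, w, hz, hc⟩ := hneg
    exact Or.inl (h.infCost_eq_bot_of_cost_neg hz hc)
  · push Not at hneg
    refine Or.inr ⟨le_antisymm (sInf_le ⟨x, v, hd.admissible, by simp [hd.cost_eq_zero]⟩)
      (le_sInf ?_), x, v, hd.admissible, hd.cost_eq_zero, hd.input_ne_zero⟩
    rintro c ⟨z, w, hz, rfl⟩
    exact EReal.coe_nonneg.2 (hneg z w hz)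

/-- If the state at time `τ` can be moved in the direction `η` from the origin, then the infimum
is `-∞` everywhere. -/
theorem IsDegenerate.infCost_eq_bot_of_reachable (h : P.IsRegular) {τ : ℝ} (hτ : τ ∈ Icc 0 P.T)
    {η : Fin n → ℝ} {x : ℝ → Fin n → ℝ} {v : ℝ → Fin m → ℝ} (hd : P.IsDegenerate τ η x v)
    {y : Fin n → ℝ} (hy : P.CanSteer 0 τ 0 y) (hηy : η ⬝ᵥ y ≠ 0) (x₀ : Fin n → ℝ) :
    P.infCost x₀ = ⊥ := by
  obtain ⟨z₁, w₁, hz₁, h0, hzτ⟩ := hy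
  obtain ⟨z₂, hz₂τ, hz₂⟩ := h.exists_trajectory hτ.1 le_rfl (left_mem_Icc.2 hτ.2) y
    (v := 0) MemLp.zero
  have hz := h.isTrajectory_glue le_rfl hτ.1 hτ.2 le_rfl hz₁ hz₂ (hzτ.trans hz₂τ.symm)
  have hz0 : (Iic τ).piecewise z₁ z₂ 0 = 0 := by
    rw [piecewise_eq_of_mem _ _ _ (mem_Iic.2 hτ.1), h0]
  have hzy : (Iic τ).piecewise z₁ z₂ τ = y := by
    rw [piecewise_eq_of_mem _ _ _ (mem_Iic.2 le_rfl), hzτ]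
  obtain ⟨z, hzad⟩ := h.exists_admissible x₀
  -- If the zero-input trajectory from `x₀` does not see `η`, adding the trajectory from the origin
  -- through `y` makes the pairing `η · y`.
  by_cases hη : η ⬝ᵥ z τ = 0
  · refine hd.infCost_eq_bot h (z := fun t => z t + (1 : ℝ) • (Iic τ).piecewise z₁ z₂ t)
      ⟨h.isTrajectory_add_smul le_rfl h.horizon_pos.le le_rfl hzad.1 hz 1, ?_⟩ ?_
    · simp [hz0, hzad.2]
    · rw [hzy, one_smul, dotProduct_add, hη, zero_add]
      exact hηy
  · exact hd.infCost_eq_bot h hzad hη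

/-- If every state steerable to the origin after `τ` is reachable before `τ`, then some reachable
state is not orthogonal to the costate. -/
theorem IsTerminalSolution.exists_reachable (h : P.IsRegular)
    {X Y : ℝ → Matrix (Fin n) (Fin n) ℝ} (hXY : P.IsTerminalSolution X Y) {τ : ℝ}
    (hτ : τ ∈ Icc 0 P.T) {ξ : Fin n → ℝ} (hξ : ξ ≠ 0) (hX : X τ *ᵥ ξ = 0)
    (hsteer : ∀ y, P.CanSteer τ P.T y 0 → P.CanSteer 0 τ 0 y) :
    ∃ y, P.CanSteer 0 τ 0 y ∧ (Y τ *ᵥ ξ) ⬝ᵥ y ≠ 0 := by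
  obtain ⟨p, hpτ, hp⟩ := h.exists_adjoint hτ (Y τ *ᵥ ξ)
  have hp' := hp.mono hτ.1 le_rfl
  -- The input `Bᵀ p` is run with final state zero, so `z(τ)` is steerable to the origin and `η ·
  -- z(τ) = -∫ |Bᵀ p|²` over `[τ, T]`.
  obtain ⟨z, hzT, hz⟩ := h.exists_trajectory hτ.1 le_rfl (right_mem_Icc.2 hτ.2) 0
    (h.memLp_adjoint_input hτ.1 le_rfl hp'.continuousOn)
  refine ⟨z τ, hsteer _ ⟨z, _, hz, rfl, hzT⟩, fun h0 => ?_⟩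
  refine hXY.not_adjoint_input_eq_zero h hτ hξ hX hp' hpτ
    (h.adjoint_input_eq_zero hτ.1 hτ.2 le_rfl hp' hz ?_)
  rw [hzT, dotProduct_zero, hpτ, h0]

/-- For constant `A` and `B`, some state reachable in positive time is not orthogonal to the
costate. -/
theorem IsTerminalSolution.exists_reachable_of_const (h : P.IsRegular)
    {X Y : ℝ → Matrix (Fin n) (Fin n) ℝ} (hXY : P.IsTerminalSolution X Y) {τ : ℝ}
    (hτ : τ ∈ Icc 0 P.T) (hτpos : 0 < τ) {ξ : Fin n → ℝ} (hξ : ξ ≠ 0) (hX : X τ *ᵥ ξ = 0)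
    {A₀ : Matrix (Fin n) (Fin n) ℝ} {B₀ : Matrix (Fin n) (Fin m) ℝ}
    (hAB : ∀ᵐ t ∂(volume.restrict (Icc 0 P.T)), P.A t = A₀ ∧ P.B t = B₀) :
    ∃ y, P.CanSteer 0 τ 0 y ∧ (Y τ *ᵥ ξ) ⬝ᵥ y ≠ 0 := by
  set η := Y τ *ᵥ ξ
  let L : (Fin n → ℝ) →L[ℝ] (Fin n → ℝ) := (-A₀ᵀ).mulVecLin.toContinuousLinearMap
  let e : ((Fin n → ℝ) →L[ℝ] (Fin n → ℝ)) →L[ℝ] (Fin n → ℝ) :=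
    ContinuousLinearMap.apply ℝ (Fin n → ℝ) η
  let β : (Fin n → ℝ) →L[ℝ] (Fin m → ℝ) := B₀ᵀ.mulVecLin.toContinuousLinearMap
  -- For constant `A` the adjoint solution through `η` is a matrix exponential, hence analytic in
  -- time.
  set p : ℝ → Fin n → ℝ := fun t => e (NormedSpace.exp ((t - τ) • L))
  have hderiv : ∀ t, HasDerivAt p (L (p t)) t := by
    intro t
    have h1 : HasDerivAt (fun t : ℝ => NormedSpace.exp ((t - τ) • L))
        (L * NormedSpace.exp ((t - τ) • L)) t :=
      (hasDerivAt_exp_smul_const' (𝕂 := ℝ) L (t - τ)).comp_sub_const t τ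
    exact e.hasFDerivAt.comp_hasDerivAt t h1
  have hpc : Continuous p := continuous_iff_continuousAt.2 fun t => (hderiv t).continuousAt
  have hpτ : p τ = η := by simp [p, e]
  have hp : IsVectorPrimitiveOn p (fun t => -((P.A t)ᵀ *ᵥ p t)) 0 P.T := by
    have : IsVectorPrimitiveOn p (fun t => L (p t)) 0 P.T := fun i =>
      IsPrimitiveOn.of_hasDerivAt (fun t => (hasDerivAt_pi.1 (hderiv t)) i)
        ((continuous_apply i).comp (L.continuous.comp hpc))
    refine this.congr_deriv ?_
    filter_upwards [hAB] with t ht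
    rw [ht.1]
    exact (Matrix.neg_mulVec (p t) A₀ᵀ).symm
  have hp' := hp.mono le_rfl hτ.2
  obtain ⟨z, hz0, hz⟩ := h.exists_trajectory le_rfl hτ.2 (left_mem_Icc.2 hτ.1) 0
    (h.memLp_adjoint_input le_rfl hτ.2 hp'.continuousOn)
  refine ⟨z τ, ⟨z, _, hz, hz0, rfl⟩, fun h0 => ?_⟩
  have hzero := h.adjoint_input_eq_zero le_rfl hτ.1 hτ.2 hp' hz (by
    rw [hpτ, h0, hz0, dotProduct_zero])
  have hae : (fun t => β (p t)) =ᵐ[volume.restrict (Icc 0 τ)] fun _ => 0 := by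
    filter_upwards [hzero, ae_restrict_Icc_mono le_rfl hτ.2 hAB] with t ht hB
    rw [hB.2] at ht
    exact ht
  have heq := Measure.eqOn_Icc_of_ae_eq volume hτpos.ne hae
    (β.continuous.comp hpc).continuousOn continuousOn_const
  have hanal : AnalyticOnNhd ℝ (fun t => β (p t)) univ := by
    intro t _
    have h1 : AnalyticAt ℝ (fun t : ℝ => (t - τ) • L) t := by fun_prop
    exact ((β.comp e).analyticAt _).comp ((NormedSpace.exp_analytic (𝕂 := ℝ) _).comp h1)
  -- If `Bᵀ p` vanishes on `[0, τ]`, it vanishes near the interior point `τ / 2`, which exists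
  -- because `τ > 0`, and so for all times. On `[τ, T]` this is impossible.
  have hall := hanal.eq_of_eventuallyEq (g := fun _ => 0) analyticOnNhd_const (z₀ := τ / 2)
    (heq.eventuallyEq_of_mem (Icc_mem_nhds (by linarith) (by linarith)))
  refine hXY.not_adjoint_input_eq_zero h hτ hξ hX (hp.mono hτ.1 le_rfl) hpτ ?_
  filter_upwards [ae_restrict_Icc_mono hτ.1 le_rfl hAB] with t hB
  rw [hB.2]
  exact congrFun hall t

/-! ### From maximal solutions back to the Riccati equation, and the theorem. -/

/-- A maximal solution of the DLMI solves the Riccati equation. -/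
theorem IsMaximalDLMISolution.isDRESolution (h : P.IsRegular)
    {L : ℝ → Matrix (Fin n) (Fin n) ℝ} (hL : P.IsMaximalDLMISolution L) :
    P.IsDRESolution 0 L := by
  have h0T : (0 : ℝ) ∈ Icc 0 P.T := left_mem_Icc.2 h.horizon_pos.le
  obtain ⟨X, Y, hXY⟩ := h.exists_terminalSolution
  by_cases hX : ∀ t ∈ Icc 0 P.T, IsUnit (X t).det
  · have hdre := hXY.isDRESolution h h0T hX
    have hmax := hdre.isMaximalDLMISolution h
    -- Two maximal solutions dominate each other, so they agree.
    have heq : ∀ t ∈ Icc 0 P.T, L t = Y t * (X t)⁻¹ := by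
      intro t ht
      open scoped MatrixOrder in
      exact le_antisymm (Matrix.le_iff.2 (hmax.2 L hL.1 t ht)) (Matrix.le_iff.2 (hL.2 _ hmax.1 t ht))
    obtain ⟨D, hD, hric⟩ := hdre
    refine ⟨D, ⟨hD.1, fun t ht => heq t ht ▸ hD.2.1 t ht, fun t ht => heq t ht ▸ hD.2.2 t ht⟩, ?_⟩
    filter_upwards [hric, ae_restrict_mem measurableSet_Icc] with t h1 ht
    rw [heq t ht]
    exact h1
  -- A singular `X` would give an initial state with infimum `-∞`, whereas any DLMI solution bounds
  -- the infimum below by a real number.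
  · push Not at hX
    obtain ⟨τ, hτ, hu⟩ := hX
    obtain ⟨ξ, hξ, hXξ, hYξ⟩ := hXY.exists_kernel h hτ hu
    obtain ⟨x, v, hd⟩ := hXY.exists_isDegenerate h hτ hξ hXξ
    obtain ⟨S, hS, hbot⟩ := hd.exists_submodule h hτ hYξ
    obtain ⟨x₀, hx₀⟩ : ∃ x₀, x₀ ∉ S := by
      by_contra! hall
      exact hS (Submodule.eq_top_iff'.2 hall)
    have hle : ((x₀ ⬝ᵥ (L 0 *ᵥ x₀) : ℝ) : EReal) ≤ P.infCost x₀ := by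
      refine le_sInf ?_
      rintro c ⟨z, w, hz, rfl⟩
      have := h.le_integral_form h0T hL.1 hz.1
      rw [hz.2] at this
      exact EReal.coe_le_coe_iff.2 this
    rw [hbot x₀ hx₀] at hle
    exact absurd hle (by simp)

end LQProblem

theorem theorem2 {n m : ℕ} (P : LQProblem n m) (hT : 0 < P.T)
    (hA : IsBoundedMatrixFun P.T P.A) (hB : IsBoundedMatrixFun P.T P.B)
    (hQ : IsBoundedMatrixFun P.T P.Q) (hN : IsBoundedMatrixFun P.T P.N)
    (hR : IsBoundedMatrixFun P.T P.R)
    (hQsymm : ∀ᵐ t ∂(volume.restrict (Icc 0 P.T)), (P.Q t).IsSymm)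
    (hRpos : ∃ ρ : ℝ, 0 < ρ ∧ ∀ᵐ t ∂(volume.restrict (Icc 0 P.T)),
      (P.R t - ρ • (1 : Matrix (Fin m) (Fin m) ℝ)).PosSemidef) :
    -- The maximal solution of the DLMI is the solution of the DRE, and it gives the infimum.
    (∀ Λ, P.IsMaximalDLMISolution Λ ↔ P.IsDRESolution 0 Λ) ∧
    (∀ Λ, P.IsMaximalDLMISolution Λ →
      ∀ x₀, P.infCost x₀ = ((x₀ ⬝ᵥ (Λ 0 *ᵥ x₀) : ℝ) : EReal)) ∧
    -- Finite escape time.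
    (∀ τ, P.DREEscapesAt τ →
      (∃ S : Submodule ℝ (Fin n → ℝ), S ≠ ⊤ ∧ ∀ x₀, x₀ ∉ S → P.infCost x₀ = ⊥) ∧
      ((∀ x₀, P.infCost x₀ = ⊥) ∨
        (P.infCost 0 = 0 ∧ ∃ x v, P.IsAdmissible 0 x v ∧ P.cost x v = 0 ∧
          ¬ ∀ᵐ t ∂(volume.restrict (Icc 0 P.T)), v t = 0)) ∧
      ((∀ y, P.CanSteer τ P.T y 0 → P.CanSteer 0 τ 0 y) → ∀ x₀, P.infCost x₀ = ⊥) ∧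
      (0 < τ →
        (∃ A₀ B₀, ∀ᵐ t ∂(volume.restrict (Icc 0 P.T)), P.A t = A₀ ∧ P.B t = B₀) →
        ∀ x₀, P.infCost x₀ = ⊥)) ∧
    -- No finite escape time: the maximal solution exists, and state feedback is optimal.
    ((¬ ∃ τ, P.DREEscapesAt τ) →
      ∃ Λ, P.IsMaximalDLMISolution Λ ∧
        ∀ x₀, (∃ x v, P.IsAdmissible x₀ x v ∧ P.IsFeedback Λ x v) ∧
          ∀ x v, P.IsAdmissible x₀ x v →
            ((P.cost x v : EReal) = P.infCost x₀ ↔ P.IsFeedback Λ x v)) := by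
  have h : P.IsRegular := ⟨hT, hA, hB, hQ, hN, hR, hQsymm, hRpos⟩
  obtain ⟨X, Y, hXY⟩ := h.exists_terminalSolution
  refine ⟨fun Λ => ⟨fun hΛ => hΛ.isDRESolution h, fun hΛ => hΛ.isMaximalDLMISolution h⟩,
    fun Λ hΛ => (hΛ.isDRESolution h).infCost_eq h, fun τ hτ => ?_, fun hesc => ?_⟩
  · have hτT : τ ∈ Icc 0 P.T := ⟨hτ.1.1, hτ.1.2.le⟩
    obtain ⟨ξ, hξ, hXξ, hYξ⟩ := hXY.exists_kernel h hτT (hτ.not_isUnit_det h hXY)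
    obtain ⟨x, v, hd⟩ := hXY.exists_isDegenerate h hτT hξ hXξ
    refine ⟨hd.exists_submodule h hτT hYξ, hd.bot_or_degenerate h, fun hsteer => ?_, ?_⟩
    · obtain ⟨y, hy, hηy⟩ := hXY.exists_reachable h hτT hξ hXξ hsteer
      exact hd.infCost_eq_bot_of_reachable h hτT hy hηy
    · rintro hτpos ⟨A₀, B₀, hAB⟩
      obtain ⟨y, hy, hηy⟩ := hXY.exists_reachable_of_const h hτT hτpos hξ hXξ hAB
      exact hd.infCost_eq_bot_of_reachable h hτT hy hηy
  · have hX : ∀ t ∈ Icc 0 P.T, IsUnit (X t).det := by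
      by_contra! hX
      exact hesc (hXY.exists_escape h hX)
    have hL := hXY.isDRESolution h (left_mem_Icc.2 hT.le) hX
    refine ⟨_, hL.isMaximalDLMISolution h, fun x₀ => ⟨?_, fun x v hx => ?_⟩⟩
    · obtain ⟨x, v, hx, hx₀, herr⟩ := hL.exists_feedback h (left_mem_Icc.2 hT.le) x₀
      exact ⟨x, v, ⟨hx, hx₀⟩, LQProblem.isFeedback_iff.2 (Eventually.of_forall herr)⟩
    · rw [hL.infCost_eq h, EReal.coe_eq_coe_iff]
      exact (hL.cost_eq_iff h hx).2
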